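/- Let $R$ be a commutative ring, $\underline{x}=x_1,\dots,x_r$ a sequence of elements of $R$ and $M$ an $R$-module. Notation. For $n\ge 0$ put $\underline{x}^{(n)}=x_1^n,\dots,x_r^n$. For an $R$-module $X$, let $H_i(\underline{x}^{(n)};X)$ denote Koszul homology. The sequence $\underline{x}$ is called $X$-weakly pro-regular if for every $i>0$ and every $n$ there is an $m\ge n$ such that the natural map $H_i(\underline{x}^{(m)};X)\to H_i(\underline{x}^{(n)};X)$ is zero. Let $\mathcal{L}_{\underline{x}}$ be the standard bounded free resolution of the Čech complex of $\underline{x}$, namely the Koszul cocomplex $K^{\bullet}(\underline{x}-\underline{U};R[\underline{U}^{-1}])$ in degrees $0,\dots,r$, where $R[\underline{U}^{-1}]$ is the module of inverse polynomials in $\underline{U}=U_1,\dots,U_r$. The Čech homology of $X$ is $\check{H}_i^{\underline{x}}(X)=H_i(\operatorname{Hom}_R(\mathcal{L}_{\underline{x}},X))$. Let $\Lambda^{\underline{x}}(X)$ be the $\underline{x}R$-adic completion of $X$. There is a natural homomorphism $\check{H}_0^{\underline{x}}(X)\to\Lambda^{\underline{x}}(X)$, induced by $\operatorname{Hom}_R(\mathcal{L}^0_{\underline{x}},X)=X[[\underline{U}]]\to\Lambda^{\underline{x}}(X)$,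 $\sum_b m_b\underline{U}^b\mapsto\sum_b \underline{x}^b m_b$; we write $\check{H}_0^{\underline{x}}(X)=\Lambda^{\underline{x}}(X)$ if it is an isomorphism. For a set $S$ let $X^{(S)}=\bigoplus_{s\in S}X$, and let $X[T]$ be the module of polynomials in one variable $T$ with coefficients in $X$. Theorem 3.4. The following conditions are equivalent: (i) $\underline{x}$ is $M$-weakly pro-regular. (ii) For every set $S$, $\check{H}_i^{\underline{x}}(M^{(S)})=0$ for all $i>0$ and $\check{H}_0^{\underline{x}}(M^{(S)})=\Lambda^{\underline{x}}(M^{(S)})$. (iii) $\check{H}_i^{\underline{x}}(M[T])=\check{H}_i^{\underline{x}}(M)=0$ for all $i>0$, $\check{H}_0^{\underline{x}}(M[T])=\Lambda^{\underline{x}}(M[T])$ and $\check{H}_0^{\underline{x}}(M)=\Lambda^{\underline{x}}(M)$. (iv) $\check{H}_i^{\underline{x}}(M[T])=0$ for all $i>0$ and $\check{H}_0^{\underline{x}}(M[T])=\Lambda^{\underline{x}}(M[T])$. -/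

import Mathlib

open CategoryTheory

universe u v w

/-! ### Signs of the Koszul differentials -/

/-- The sign of `e_i ∧ e_S` relative to `e_{S ∪ {i}}`: it is `(-1)` to the number of
elements of `S` that are smaller than `i`. -/
def koszulSign {r : ℕ} (i : Fin r) (S : Finset (Fin r)) : ℤ :=
  (-1) ^ (S.filter (fun j => j < i)).card

theorem koszulSign_insert_swap {r : ℕ} (i j : Fin r) (S : Finset (Fin r))
    (hij : i ≠ j) (hi : i ∉ S) (hj : j ∉ S) :
    koszulSign i S * koszulSign j (insert i S) =
      -(koszulSign j S * koszulSign i (insert j S)) := by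
  unfold koszulSign
  rw [Finset.filter_insert, Finset.filter_insert]
  rcases lt_or_gt_of_ne hij with h | h
  · rw [if_pos h, if_neg (not_lt_of_gt h), Finset.card_insert_of_notMem (by simp [hi])]
    ring
  · rw [if_neg (not_lt_of_gt h), if_pos h, Finset.card_insert_of_notMem (by simp [hj])]
    ring

/-- An alternating double sum vanishes. -/
theorem sum_sum_eq_zero_of_alternating {r : ℕ} {N : Type*} [AddCommGroup N]
    (F : Fin r → Fin r → N) (h0 : ∀ i, F i i = 0) (h : ∀ i j, i ≠ j → F i j + F j i = 0) :
    ∑ i, ∑ j, F i j = 0 := by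
  rw [← Fintype.sum_prod_type' F]
  refine Finset.sum_involution (fun p _ => (p.2, p.1)) ?_ ?_ ?_ ?_
  · rintro ⟨i, j⟩ -
    by_cases hij : i = j
    · subst hij; simp [h0]
    · exact h i j hij
  · rintro ⟨i, j⟩ - hne heq
    simp only [Prod.mk.injEq] at heq
    apply hne
    obtain ⟨rfl, -⟩ := heq
    exact h0 _
  · intro p _; exact Finset.mem_univ _
  · intro p _; rfl

/-- The subsets of `{1, …, r}` with `k` elements; they index the standard basis
`e_S = e_{i₁} ∧ ⋯ ∧ e_{i_k}` of the `k`-th exterior power of the free module of rank `r`. -/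
abbrev KoszulIndex (r k : ℕ) : Type := {S : Finset (Fin r) // S.card = k}

/-! ### The Koszul complex `K_•(a; M)` and Koszul homology -/

section KoszulChain

variable {R : Type u} [CommRing R] {r : ℕ}

/-- The Koszul differential `K_{k+1}(a; M) → K_k(a; M)`. An element of `K_k(a; M)` is a family
`f = ∑_S f_S e_S`, and the `T`-component of the differential of `f` is
`∑_{i ∉ T} ± a_i f_{T ∪ {i}}`. -/
def koszulD (a : Fin r → R) (M : Type v) [AddCommGroup M] [Module R M] (k : ℕ) :
    (KoszulIndex r (k + 1) → M) →ₗ[R] (KoszulIndex r k → M) where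
  toFun f T := ∑ i : Fin r, if h : i ∈ T.1 then 0 else
    koszulSign i T.1 • a i • f ⟨insert i T.1, by rw [Finset.card_insert_of_notMem h, T.2]⟩
  map_add' f g := by
    funext T
    simp only [Pi.add_apply, ← Finset.sum_add_distrib]
    refine Finset.sum_congr rfl fun i _ => ?_
    split_ifs <;> simp
  map_smul' c f := by
    funext T
    simp only [Pi.smul_apply, RingHom.id_apply, Finset.smul_sum]
    refine Finset.sum_congr rfl fun i _ => ?_
    split_ifs
    · simp
    · rw [smul_comm (a i) c, smul_comm _ c]

theorem koszulD_apply (a : Fin r → R) (M : Type v) [AddCommGroup M] [Module R M] (k : ℕ)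
    (f : KoszulIndex r (k + 1) → M) (T : KoszulIndex r k) :
    koszulD a M k f T = ∑ i : Fin r, if h : i ∈ T.1 then 0 else
      koszulSign i T.1 • a i •
        f ⟨insert i T.1, by rw [Finset.card_insert_of_notMem h, T.2]⟩ := rfl

theorem koszulD_comp (a : Fin r → R) (M : Type v) [AddCommGroup M] [Module R M] (k : ℕ) :
    koszulD a M k ∘ₗ koszulD a M (k + 1) = 0 := by
  refine LinearMap.ext fun f => funext fun T => ?_
  rw [LinearMap.comp_apply, koszulD_apply]
  simp only [koszulD_apply, LinearMap.zero_apply, Pi.zero_apply]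
  let F : Fin r → Fin r → M := fun i j =>
    if h : i ∉ T.1 ∧ j ∉ insert i T.1 then
      (koszulSign i T.1 * koszulSign j (insert i T.1)) • (a i * a j) •
        f ⟨insert j (insert i T.1), by
          rw [Finset.card_insert_of_notMem h.2, Finset.card_insert_of_notMem h.1, T.2]⟩
    else 0
  have key : ∑ i, ∑ j, F i j = 0 := by
    refine sum_sum_eq_zero_of_alternating F (fun i => ?_) (fun i j hij => ?_)
    · simp [F]
    · by_cases h : i ∉ T.1 ∧ j ∉ T.1
      · obtain ⟨hi, hj⟩ := h
        have h1 : i ∉ T.1 ∧ j ∉ insert i T.1 := ⟨hi, by simp [hj, Ne.symm hij]⟩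
        have h2 : j ∉ T.1 ∧ i ∉ insert j T.1 := ⟨hj, by simp [hi, hij]⟩
        simp only [F]
        rw [dif_pos h1, dif_pos h2, koszulSign_insert_swap i j T.1 hij hi hj, mul_comm (a i)]
        have : insert j (insert i T.1) = insert i (insert j T.1) := Finset.insert_comm _ _ _
        simp only [this, neg_smul, neg_add_cancel]
      · have h1 : ¬ (i ∉ T.1 ∧ j ∉ insert i T.1) := by
          simp only [Finset.mem_insert]; tauto
        have h2 : ¬ (j ∉ T.1 ∧ i ∉ insert j T.1) := by
          simp only [Finset.mem_insert]; tauto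
        simp only [F]
        rw [dif_neg h1, dif_neg h2, add_zero]
  refine Eq.trans (Finset.sum_congr rfl fun i _ => ?_) key
  by_cases hi : i ∈ T.1
  · simp [F, hi]
  · rw [dif_neg hi, Finset.smul_sum, Finset.smul_sum]
    refine Finset.sum_congr rfl fun j _ => ?_
    by_cases hj : j ∈ insert i T.1
    · rw [dif_pos hj, smul_zero, smul_zero]
      have hn : ¬ (i ∉ T.1 ∧ j ∉ insert i T.1) := fun h => h.2 hj
      simp only [F]
      rw [dif_neg hn]
    · rw [dif_neg hj]
      simp only [F]
      rw [dif_pos ⟨hi, hj⟩, mul_smul, mul_smul, smul_comm (a i) (koszulSign j _)]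

/-- The Koszul complex `K_•(a; M)` of a sequence `a = a_1, …, a_r` on a module `M`. -/
noncomputable def koszulComplex (a : Fin r → R) (M : Type v) [AddCommGroup M] [Module R M] :
    ChainComplex (ModuleCat.{v} R) ℕ :=
  ChainComplex.of (fun k => ModuleCat.of R (KoszulIndex r k → M))
    (fun k => ModuleCat.ofHom (koszulD a M k))
    (fun k => by rw [← ModuleCat.ofHom_comp, koszulD_comp]; rfl)

theorem koszulComplex_d (a : Fin r → R) (M : Type v) [AddCommGroup M] [Module R M] (k : ℕ) :
    (koszulComplex a M).d (k + 1) k = ModuleCat.ofHom (koszulD a M k) :=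
  ChainComplex.of_d (fun k => ModuleCat.of R (KoszulIndex r k → M))
    (fun k => ModuleCat.ofHom (koszulD a M k)) k

/-- The Koszul homology module `H_i(a; M)`. -/
noncomputable abbrev koszulHomology (a : Fin r → R) (M : Type v) [AddCommGroup M] [Module R M]
    (i : ℕ) : ModuleCat.{v} R :=
  (koszulComplex a M).homology i

/-- The map `K_k(x^(m); M) → K_k(x^(n); M)`, `e_S ↦ (∏_{i ∈ S} x_i ^ (m - n)) e_S`. -/
def koszulPowMap (x : Fin r → R) (M : Type v) [AddCommGroup M] [Module R M] (m n k : ℕ) :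
    (KoszulIndex r k → M) →ₗ[R] (KoszulIndex r k → M) :=
  LinearMap.pi fun S => (∏ i ∈ S.1, x i ^ (m - n)) • LinearMap.proj S

theorem koszulPowMap_comm (x : Fin r → R) (M : Type v) [AddCommGroup M] [Module R M]
    {m n : ℕ} (h : n ≤ m) (k : ℕ) :
    koszulD (fun i => x i ^ n) M k ∘ₗ koszulPowMap x M m n (k + 1) =
      koszulPowMap x M m n k ∘ₗ koszulD (fun i => x i ^ m) M k := by
  refine LinearMap.ext fun f => funext fun T => ?_
  simp only [LinearMap.comp_apply, koszulD_apply, koszulPowMap, LinearMap.pi_apply,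
    LinearMap.smul_apply, LinearMap.proj_apply, Finset.smul_sum]
  refine Finset.sum_congr rfl fun i _ => ?_
  by_cases hi : i ∈ T.1
  · simp [hi]
  · rw [dif_neg hi, dif_neg hi, Finset.prod_insert hi, smul_comm (∏ i ∈ T.1, _) (koszulSign _ _)]
    simp only [smul_smul]
    congr 2
    rw [← mul_assoc, ← pow_add, Nat.add_sub_cancel' h, mul_comm]

/-- The natural map of Koszul complexes `K_•(x^(m); M) → K_•(x^(n); M)` for `n ≤ m`, where
`x^(n) = x_1 ^ n, …, x_r ^ n`. -/
noncomputable def koszulTransition (x : Fin r → R) (M : Type v) [AddCommGroup M] [Module R M]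
    {m n : ℕ} (h : n ≤ m) :
    koszulComplex (fun i => x i ^ m) M ⟶ koszulComplex (fun i => x i ^ n) M :=
  ChainComplex.ofHom (fun k => ModuleCat.ofHom (koszulPowMap x M m n k))
    (fun k => by
      rw [koszulComplex_d, koszulComplex_d]
      exact congrArg ModuleCat.ofHom (koszulPowMap_comm x M h k))

/-- The sequence `x = x_1, …, x_r` is `M`-weakly pro-regular: for every `i > 0` the inverse
system `{H_i(x^(n); M)}_n` of Koszul homology modules is pro-zero, that is, for each `n` there
is an `m ≥ n` such that the natural map `H_i(x^(m); M) → H_i(x^(n); M)` is zero. -/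
def IsWeaklyProRegular (x : Fin r → R) (M : Type v) [AddCommGroup M] [Module R M] : Prop :=
  ∀ i : ℕ, 0 < i → ∀ n : ℕ, ∃ (m : ℕ) (h : n ≤ m),
    HomologicalComplex.homologyMap (koszulTransition x M h) i = 0

end KoszulChain

/-! ### The free resolution of the Čech complex -/

section CechResolution

variable {R : Type u} [CommRing R] {r : ℕ}

/-- The `R`-module `R[U⁻¹]` of inverse polynomials in the variables `U_1, …, U_r`: the free
module whose basis element `Finsupp.single b 1` is the monomial
`U_1 ^ (-b_1) ⋯ U_r ^ (-b_r)`. -/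
abbrev InvPoly (R : Type u) [CommRing R] (r : ℕ) : Type u := (Fin r → ℕ) →₀ R

/-- Multiplication by `U_i` on inverse polynomials. It maps `U^(-b)` to `U^(-(b - δ_i))` if
`b_i > 0` and to zero if `b_i = 0`; that is, the coefficient of `U_i f` at `b` is the
coefficient of `f` at `b + δ_i`. -/
noncomputable def InvPoly.mulU (R : Type u) [CommRing R] {r : ℕ} (i : Fin r) :
    InvPoly R r →ₗ[R] InvPoly R r :=
  Finsupp.lcomapDomain (fun b => b + Pi.single i 1) (add_left_injective _)

/-- Multiplication by `x_i - U_i` on inverse polynomials. -/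
noncomputable def InvPoly.mulSub (x : Fin r → R) (i : Fin r) : InvPoly R r →ₗ[R] InvPoly R r :=
  x i • LinearMap.id - InvPoly.mulU R i

theorem InvPoly.mulSub_apply (x : Fin r → R) (i : Fin r) (f : InvPoly R r) (b : Fin r → ℕ) :
    InvPoly.mulSub x i f b = x i * f b - f (b + Pi.single i 1) := by
  simp [InvPoly.mulSub, InvPoly.mulU, Finsupp.lcomapDomain, Finsupp.comapDomain_apply]

theorem InvPoly.mulSub_comm (x : Fin r → R) (i j : Fin r) (f : InvPoly R r) :
    InvPoly.mulSub x i (InvPoly.mulSub x j f) = InvPoly.mulSub x j (InvPoly.mulSub x i f) := by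
  ext b
  simp only [InvPoly.mulSub_apply]
  rw [add_right_comm b]
  ring

/-- The differential in cohomological degree `k` of the Koszul cocomplex
`K^•(x - U; R[U⁻¹])`: the `T`-component of the differential of `f = ∑_S f_S e_S` is
`∑_{i ∈ T} ± (x_i - U_i) f_{T \ {i}}`. -/
noncomputable def cechResolutionD (x : Fin r → R) (k : ℕ) :
    (KoszulIndex r k → InvPoly R r) →ₗ[R] (KoszulIndex r (k + 1) → InvPoly R r) where
  toFun f T := ∑ i : Fin r, if h : i ∈ T.1 then
    koszulSign i (T.1.erase i) • InvPoly.mulSub x i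
      (f ⟨T.1.erase i, by rw [Finset.card_erase_of_mem h, T.2, Nat.add_sub_cancel]⟩) else 0
  map_add' f g := by
    funext T
    simp only [Pi.add_apply, ← Finset.sum_add_distrib]
    refine Finset.sum_congr rfl fun i _ => ?_
    split_ifs <;> simp
  map_smul' c f := by
    funext T
    simp only [Pi.smul_apply, RingHom.id_apply, Finset.smul_sum]
    refine Finset.sum_congr rfl fun i _ => ?_
    split_ifs
    · rw [map_smul, smul_comm _ c]
    · simp

theorem cechResolutionD_apply (x : Fin r → R) (k : ℕ) (f : KoszulIndex r k → InvPoly R r)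
    (T : KoszulIndex r (k + 1)) :
    cechResolutionD x k f T = ∑ i : Fin r, if h : i ∈ T.1 then
      koszulSign i (T.1.erase i) • InvPoly.mulSub x i
        (f ⟨T.1.erase i, by rw [Finset.card_erase_of_mem h, T.2, Nat.add_sub_cancel]⟩)
      else 0 := rfl

theorem cechResolutionD_comp (x : Fin r → R) (k : ℕ) :
    cechResolutionD x (k + 1) ∘ₗ cechResolutionD x k = 0 := by
  refine LinearMap.ext fun f => funext fun T => ?_
  rw [LinearMap.comp_apply, cechResolutionD_apply]
  simp only [cechResolutionD_apply, LinearMap.zero_apply, Pi.zero_apply]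
  let F : Fin r → Fin r → InvPoly R r := fun i j =>
    if h : i ∈ T.1 ∧ j ∈ T.1.erase i then
      (koszulSign i (T.1.erase i) * koszulSign j ((T.1.erase i).erase j)) •
        InvPoly.mulSub x i (InvPoly.mulSub x j (f ⟨(T.1.erase i).erase j, by
          rw [Finset.card_erase_of_mem h.2, Finset.card_erase_of_mem h.1, T.2]; rfl⟩))
    else 0
  have key : ∑ i, ∑ j, F i j = 0 := by
    refine sum_sum_eq_zero_of_alternating F (fun i => ?_) (fun i j hij => ?_)
    · simp [F]
    · by_cases h : i ∈ T.1 ∧ j ∈ T.1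
      · obtain ⟨hi, hj⟩ := h
        have h1 : i ∈ T.1 ∧ j ∈ T.1.erase i := ⟨hi, by simp [hj, Ne.symm hij]⟩
        have h2 : j ∈ T.1 ∧ i ∈ T.1.erase j := ⟨hj, by simp [hi, hij]⟩
        have e : (T.1.erase j).erase i = (T.1.erase i).erase j := Finset.erase_right_comm
        have e1 : T.1.erase i = insert j ((T.1.erase i).erase j) :=
          (Finset.insert_erase h1.2).symm
        have e2 : T.1.erase j = insert i ((T.1.erase i).erase j) := by
          rw [← e]; exact (Finset.insert_erase h2.2).symm
        have hs := koszulSign_insert_swap i j ((T.1.erase i).erase j) hij (by simp) (by simp)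
        rw [← e1, ← e2] at hs
        simp only [F]
        rw [dif_pos h1, dif_pos h2, InvPoly.mulSub_comm x j i]
        simp only [e]
        rw [← add_smul]
        convert zero_smul ℤ _ using 2
        linear_combination hs
      · have h1 : ¬ (i ∈ T.1 ∧ j ∈ T.1.erase i) := by
          simp only [Finset.mem_erase]; tauto
        have h2 : ¬ (j ∈ T.1 ∧ i ∈ T.1.erase j) := by
          simp only [Finset.mem_erase]; tauto
        simp only [F]
        rw [dif_neg h1, dif_neg h2, add_zero]
  refine Eq.trans (Finset.sum_congr rfl fun i _ => ?_) key
  by_cases hi : i ∈ T.1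
  · rw [dif_pos hi, map_sum, Finset.smul_sum]
    refine Finset.sum_congr rfl fun j _ => ?_
    by_cases hj : j ∈ T.1.erase i
    · rw [dif_pos hj]
      simp only [F]
      rw [dif_pos ⟨hi, hj⟩, map_zsmul, mul_smul]
    · rw [dif_neg hj, map_zero, smul_zero]
      have hn : ¬ (i ∈ T.1 ∧ j ∈ T.1.erase i) := fun h => hj h.2
      simp only [F]
      rw [dif_neg hn]
  · simp [F, hi]

/-- The bounded complex `L_x` of free `R`-modules that resolves the Čech complex of
`x = x_1, …, x_r`: the Koszul cocomplex `K^•(x - U; R[U⁻¹])`, in cohomological degrees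
`0, …, r`. It is the tensor product of the complexes `R[U_i⁻¹] → R[U_i⁻¹]` with differential
`x_i - U_i`, each of which is a free resolution of `R → R_{x_i}` through the augmentation
that takes the constant coefficient in degree `0` and sends `U_i^(-b)` to `1 / x_i ^ (b + 1)`
in degree `1`. -/
noncomputable def cechResolution (x : Fin r → R) : CochainComplex (ModuleCat.{u} R) ℕ :=
  CochainComplex.of (fun k => ModuleCat.of R (KoszulIndex r k → InvPoly R r))
    (fun k => ModuleCat.ofHom (cechResolutionD x k))
    (fun k => by rw [← ModuleCat.ofHom_comp, cechResolutionD_comp]; rfl)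

theorem cechResolution_d (x : Fin r → R) (k : ℕ) :
    (cechResolution x).d k (k + 1) = ModuleCat.ofHom (cechResolutionD x k) :=
  CochainComplex.of_d (fun k => ModuleCat.of R (KoszulIndex r k → InvPoly R r))
    (fun k => ModuleCat.ofHom (cechResolutionD x k)) k

/-- The chain complex `Hom_R(L, M)` for a cochain complex `L` and a module `M`: in homological
degree `i` it is `Hom_R(L^i, M)`, with differential the composition with that of `L`. -/
noncomputable def homComplex (L : CochainComplex (ModuleCat.{u} R) ℕ)
    (M : Type v) [AddCommGroup M] [Module R M] : ChainComplex (ModuleCat.{max u v} R) ℕ where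
  X i := ModuleCat.of R (L.X i →ₗ[R] M)
  d i j := ModuleCat.ofHom (LinearMap.lcomp R M (L.d j i).hom)
  shape i j hij := by
    have : L.d j i = 0 := L.shape j i hij
    rw [this]
    refine ModuleCat.hom_ext (LinearMap.ext fun f => ?_)
    exact LinearMap.comp_zero f
  d_comp_d' i j k _ _ := by
    refine ModuleCat.hom_ext (LinearMap.ext fun (f : L.X i →ₗ[R] M) => ?_)
    have h : L.d k j ≫ L.d j i = 0 := L.d_comp_d k j i
    have h' : (L.d j i).hom ∘ₗ (L.d k j).hom = 0 := by
      rw [← ModuleCat.hom_comp, h]; rfl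
    change (f ∘ₗ (L.d j i).hom) ∘ₗ (L.d k j).hom = 0
    rw [LinearMap.comp_assoc, h', LinearMap.comp_zero]

/-- The complex `Hom_R(L_x, M)`, which represents `RHom_R` of the Čech complex into `M`. -/
noncomputable abbrev cechHomComplex (x : Fin r → R) (M : Type v) [AddCommGroup M] [Module R M] :
    ChainComplex (ModuleCat.{max u v} R) ℕ :=
  homComplex (cechResolution x) M

/-- The Čech homology module `Ȟ_i^x(M) = H_i(Hom_R(L_x, M))`. -/
noncomputable abbrev cechHomology (x : Fin r → R) (M : Type v) [AddCommGroup M] [Module R M]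
    (i : ℕ) : ModuleCat.{max u v} R :=
  (cechHomComplex x M).homology i

/-! ### The natural map from the zeroth Čech homology to the completion -/

/-- The ideal `xR` generated by the sequence `x`. -/
abbrev seqIdeal (x : Fin r → R) : Ideal R := Ideal.span (Set.range x)

/-- The `xR`-adic completion of `M`. -/
abbrev Completion (x : Fin r → R) (M : Type v) [AddCommGroup M] [Module R M] : Type v :=
  AdicCompletion (seqIdeal x) M

/-- The monomial `U^(-b)` as an element of the degree zero part of the resolution `L_x`. -/
noncomputable def cechMonomial (R : Type u) [CommRing R] {r : ℕ} (b : Fin r → ℕ) :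
    KoszulIndex r 0 → InvPoly R r :=
  fun _ => Finsupp.single b 1

/-- The exponents `b` with `b_i < n` for all `i`. -/
def expBox (r n : ℕ) : Finset (Fin r → ℕ) := Fintype.piFinset fun _ => Finset.range n

/-- Evaluation at `U = x` modulo `(xR)^n M`. A linear map `φ : R[U⁻¹] → M` is the same as the
power series `∑_b φ(U^(-b)) U^b` in `M[[U]]`; it is sent to the class of the partial sum of
`∑_b x^b φ(U^(-b))` over the `b` with all `b_i < n` (the remaining terms lie in
`(xR)^n M`). -/
noncomputable def cechEvalMod (x : Fin r → R) (M : Type v) [AddCommGroup M] [Module R M]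
    (n : ℕ) : ((KoszulIndex r 0 → InvPoly R r) →ₗ[R] M) →ₗ[R]
      (M ⧸ (seqIdeal x ^ n • ⊤ : Submodule R M)) :=
  (seqIdeal x ^ n • ⊤ : Submodule R M).mkQ ∘ₗ
    ∑ b ∈ expBox r n, (∏ i, x i ^ b i) • LinearMap.applyₗ (cechMonomial R b)

theorem cechEvalMod_apply (x : Fin r → R) (M : Type v) [AddCommGroup M] [Module R M]
    (n : ℕ) (φ : (KoszulIndex r 0 → InvPoly R r) →ₗ[R] M) :
    cechEvalMod x M n φ = (seqIdeal x ^ n • ⊤ : Submodule R M).mkQ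
      (∑ b ∈ expBox r n, (∏ i, x i ^ b i) • φ (cechMonomial R b)) := by
  simp [cechEvalMod]

theorem prod_pow_mem_seqIdeal_pow (x : Fin r → R) (b : Fin r → ℕ) (n : ℕ) (i : Fin r)
    (h : n ≤ b i) : ∏ j, x j ^ b j ∈ seqIdeal x ^ n := by
  rw [← Finset.mul_prod_erase _ _ (Finset.mem_univ i)]
  refine Ideal.mul_mem_right _ _ (Ideal.pow_le_pow_right h ?_)
  exact Ideal.pow_mem_pow (Ideal.subset_span (Set.mem_range_self i)) _

theorem cechEvalMod_transition (x : Fin r → R) (M : Type v) [AddCommGroup M] [Module R M]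
    {m n : ℕ} (h : m ≤ n) :
    AdicCompletion.transitionMap (seqIdeal x) M h ∘ₗ cechEvalMod x M n = cechEvalMod x M m := by
  refine LinearMap.ext fun φ => ?_
  rw [LinearMap.comp_apply, cechEvalMod_apply, cechEvalMod_apply]
  change (seqIdeal x ^ m • ⊤ : Submodule R M).mkQ
    (∑ b ∈ expBox r n, (∏ i, x i ^ b i) • φ (cechMonomial R b)) = _
  rw [← sub_eq_zero, ← map_sub, Submodule.mkQ_apply, Submodule.Quotient.mk_eq_zero]
  have hsub : expBox r m ⊆ expBox r n :=
    Fintype.piFinset_subset _ _ fun _ => Finset.range_mono h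
  rw [← Finset.sum_sdiff_eq_sub hsub]
  refine Submodule.sum_mem _ fun b hb => ?_
  rw [Finset.mem_sdiff] at hb
  have : ∃ i, m ≤ b i := by
    by_contra hcon
    push Not at hcon
    exact hb.2 (Fintype.mem_piFinset.2 fun i => Finset.mem_range.2 (hcon i))
  obtain ⟨i, hi⟩ := this
  exact Submodule.smul_mem_smul (prod_pow_mem_seqIdeal_pow x b m i hi) trivial

/-- Evaluation at `U = x`, from `Hom_R(L_x^0, M) = M[[U]]` to the completion of `M`. -/
noncomputable def cechEval (x : Fin r → R) (M : Type v) [AddCommGroup M] [Module R M] :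
    ((KoszulIndex r 0 → InvPoly R r) →ₗ[R] M) →ₗ[R] Completion x M :=
  AdicCompletion.lift (seqIdeal x) (cechEvalMod x M) (fun h => cechEvalMod_transition x M h)

theorem InvPoly.mulSub_single (x : Fin r → R) (i : Fin r) (b : Fin r → ℕ) :
    InvPoly.mulSub x i (Finsupp.single b 1) = x i • Finsupp.single b (1 : R) -
      if 0 < b i then Finsupp.single (b - Pi.single i 1) (1 : R) else 0 := by
  ext c
  rw [InvPoly.mulSub_apply, Finsupp.sub_apply, Finsupp.smul_apply, smul_eq_mul]
  congr 1
  split_ifs with hb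
  · rw [Finsupp.single_apply, Finsupp.single_apply]
    refine if_congr ?_ rfl rfl
    have hle : Pi.single i 1 ≤ b := by
      intro j
      by_cases hj : j = i
      · subst hj; simpa [Nat.one_le_iff_ne_zero, Nat.pos_iff_ne_zero] using hb
      · simp [hj]
    exact (tsub_eq_iff_eq_add_of_le hle).symm
  · rw [Finsupp.single_apply, if_neg, Finsupp.zero_apply]
    rintro rfl
    simp at hb

theorem mem_expBox {n : ℕ} {b : Fin r → ℕ} : b ∈ expBox r n ↔ ∀ i, b i < n := by
  simp [expBox]

/-- The partial sums telescope on a boundary. -/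
theorem boundary_sum_mem (x : Fin r → R) (M : Type v) [AddCommGroup M] [Module R M]
    (n : ℕ) (i : Fin r) (ψ : InvPoly R r →ₗ[R] M) :
    ∑ b ∈ expBox r n, (∏ j, x j ^ b j) • ψ (InvPoly.mulSub x i (Finsupp.single b 1)) ∈
      (seqIdeal x ^ n • ⊤ : Submodule R M) := by
  let g : (Fin r → ℕ) → M := fun c =>
    (∏ j, x j ^ (c + Pi.single i 1 : Fin r → ℕ) j) • ψ (Finsupp.single c 1)
  have hprod : ∀ c : Fin r → ℕ,
      ∏ j, x j ^ (c + Pi.single i 1 : Fin r → ℕ) j = (∏ j, x j ^ c j) * x i := by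
    intro c
    simp only [Pi.add_apply, pow_add, Finset.prod_mul_distrib]
    congr 1
    rw [Finset.prod_eq_single i] <;> simp +contextual
  have hle : ∀ b : Fin r → ℕ, 0 < b i → b - Pi.single i 1 + Pi.single i 1 = b := by
    intro b hb
    refine tsub_add_cancel_of_le fun j => ?_
    by_cases hj : j = i
    · subst hj; simpa [Nat.one_le_iff_ne_zero, Nat.pos_iff_ne_zero] using hb
    · simp [hj]
  have h1 : ∀ b : Fin r → ℕ,
      (∏ j, x j ^ b j) • ψ (InvPoly.mulSub x i (Finsupp.single b 1)) =
        g b - if 0 < b i then g (b - Pi.single i 1) else 0 := by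
    intro b
    rw [InvPoly.mulSub_single, map_sub, smul_sub, map_smul, smul_smul, ← hprod]
    congr 1
    split_ifs with hb
    · simp only [g]
      rw [hle b hb]
    · simp
  have h2 : ∑ b ∈ expBox r n, (if 0 < b i then g (b - Pi.single i 1) else 0) =
      ∑ c ∈ expBox r n with c i + 1 < n, g c := by
    rw [← Finset.sum_filter]
    refine Finset.sum_nbij' (fun b => b - Pi.single i 1) (fun c => c + Pi.single i 1) ?_ ?_ ?_ ?_ ?_
    · intro b hb
      rw [Finset.mem_filter, mem_expBox] at hb
      rw [Finset.mem_filter, mem_expBox]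
      refine ⟨fun j => lt_of_le_of_lt (Nat.sub_le _ _) (hb.1 j), ?_⟩
      have := hb.1 i
      have := hb.2
      simp only [Pi.sub_apply, Pi.single_eq_same]
      omega
    · intro c hc
      rw [Finset.mem_filter, mem_expBox] at hc
      rw [Finset.mem_filter, mem_expBox]
      refine ⟨fun j => ?_, by simp⟩
      by_cases hj : j = i
      · subst hj; simpa using hc.2
      · simpa [hj] using hc.1 j
    · intro b hb
      rw [Finset.mem_filter] at hb
      exact hle b hb.2
    · intro c _
      exact add_tsub_cancel_right _ _
    · intro b _
      rfl
  rw [Finset.sum_congr rfl fun b _ => h1 b, Finset.sum_sub_distrib, h2,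
    ← Finset.sum_filter_add_sum_filter_not (expBox r n) (fun c => c i + 1 < n) g,
    add_sub_cancel_left]
  refine Submodule.sum_mem _ fun c hc => ?_
  rw [Finset.mem_filter] at hc
  refine Submodule.smul_mem_smul (prod_pow_mem_seqIdeal_pow x _ n i ?_) trivial
  simpa using not_lt.1 hc.2

theorem cechEval_boundary (x : Fin r → R) (M : Type v) [AddCommGroup M] [Module R M]
    (φ : (KoszulIndex r 1 → InvPoly R r) →ₗ[R] M) :
    cechEval x M (φ ∘ₗ cechResolutionD x 0) = 0 := by
  refine AdicCompletion.ext fun n => ?_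
  change cechEvalMod x M n (φ ∘ₗ cechResolutionD x 0) = 0
  rw [cechEvalMod_apply, Submodule.mkQ_apply, Submodule.Quotient.mk_eq_zero]
  have hd : ∀ b : Fin r → ℕ, (φ ∘ₗ cechResolutionD x 0) (cechMonomial R b) =
      ∑ i : Fin r, (φ ∘ₗ LinearMap.single R (fun _ : KoszulIndex r 1 => InvPoly R r)
        ⟨{i}, Finset.card_singleton i⟩) (InvPoly.mulSub x i (Finsupp.single b 1)) := by
    intro b
    simp only [LinearMap.comp_apply]
    rw [← map_sum]
    congr 1
    funext T
    rw [cechResolutionD_apply, Finset.sum_apply]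
    obtain ⟨k, hk⟩ := Finset.card_eq_one.1 T.2
    obtain rfl : T = ⟨{k}, Finset.card_singleton k⟩ := Subtype.ext hk
    refine Finset.sum_congr rfl fun i _ => ?_
    by_cases hik : i = k
    · subst hik
      simp [cechMonomial, koszulSign]
    · have hne : (⟨{k}, Finset.card_singleton k⟩ : KoszulIndex r 1) ≠
          ⟨{i}, Finset.card_singleton i⟩ := by
        intro h
        exact hik (Finset.singleton_injective (congrArg Subtype.val h)).symm
      rw [dif_neg (by simpa using hik), LinearMap.single_apply, Pi.single_eq_of_ne hne]
  simp only [hd, Finset.smul_sum]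
  rw [Finset.sum_comm]
  exact Submodule.sum_mem _ fun i _ => boundary_sum_mem x M n i _

/-- The map of `cechEval`, as a morphism out of the degree zero part of `Hom_R(L_x, M)`; the
target is lifted to the universe of the complex. -/
noncomputable def cechEvalHom (x : Fin r → R) (M : Type v) [AddCommGroup M] [Module R M] :
    (cechHomComplex x M).X 0 ⟶ ModuleCat.of R (ULift.{max u v} (Completion x M)) :=
  ModuleCat.ofHom (ULift.moduleEquiv.symm.toLinearMap ∘ₗ cechEval x M)

theorem d_comp_cechEvalHom (x : Fin r → R) (M : Type v) [AddCommGroup M] [Module R M] :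
    (cechHomComplex x M).d 1 0 ≫ cechEvalHom x M = 0 := by
  refine ModuleCat.hom_ext (LinearMap.ext fun φ => ?_)
  have hd : ((cechResolution x).d 0 1).hom = cechResolutionD x 0 :=
    congrArg ModuleCat.Hom.hom (cechResolution_d x 0)
  refine ULift.ext _ _ ?_
  change cechEval x M ((show (KoszulIndex r 1 → InvPoly R r) →ₗ[R] M from φ) ∘ₗ
    ((cechResolution x).d 0 1).hom) = 0
  rw [hd]
  exact cechEval_boundary x M φ

/-- The natural homomorphism from the zeroth Čech homology of `M` to the `xR`-adic completion
of `M`, induced by evaluation at `U = x`, that is by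
`Hom_R(L_x^0, M) = M[[U]] → lim M / (xR)^n M`, `∑_b m_b U^b ↦ ∑_b x^b m_b`. -/
noncomputable def cechHomologyZeroToCompletion (x : Fin r → R) (M : Type v) [AddCommGroup M]
    [Module R M] : cechHomology x M 0 →ₗ[R] Completion x M :=
  ULift.moduleEquiv.toLinearMap ∘ₗ
    ((cechHomComplex x M).homologyι 0 ≫
      (cechHomComplex x M).descOpcycles (cechEvalHom x M) 1 (by simp)
        (d_comp_cechEvalHom x M)).hom

/-- The Čech homology of `M` is the completion of `M` concentrated in degree zero:
`Ȟ_i^x(M) = 0` for all `i > 0`, and the natural map from `Ȟ_0^x(M)` to the `xR`-adic completion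
of `M` is an isomorphism. -/
def CechHomologyIsCompletion (x : Fin r → R) (M : Type v) [AddCommGroup M] [Module R M] : Prop :=
  (∀ i : ℕ, 0 < i → Limits.IsZero (cechHomology x M i)) ∧
    Function.Bijective (cechHomologyZeroToCompletion x M)

end CechResolution

/-! ### Koszul differentials of commuting endomorphisms -/

section KoszulFamilies

variable {R : Type u} [CommRing R] {r : ℕ} {N : Type v} [AddCommGroup N] [Module R N]

/-! `Hom_R(L_x, X)` is the Koszul complex of the commuting operators `x_i - U_i` on `X[[U]]`, and it
is the limit, along surjections, of its truncations modulo `(U_1^n, …, U_r^n)`. The truncation at `n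
> 0` has the homology of `K_•(x^(n); X)`. In one variable the comparison is `1 ↦ 1` in degree 0 and
`1 ↦ ∑_{b<n} x^(n-1-b) U^b` in degree 1. It is a chain map because `x - U` takes that sum to `x^n -
U^n`, and division by `U - x` supplies the homotopy (`exists_std`). The comparison respects
transition maps, so weak pro-regularity says that the truncated homology is pro-zero in positive
degrees (`isWeaklyProRegular_iff_isProZeroBox`).

The rest is governed by the Milnor sequences `0 → lim¹ H_{k+1}(x^(n); X) → Ȟ_k(X) → lim H_k(x^(n);
X) → 0`, whose right-hand term for `k = 0` is the completion (`cechEval_eq_zero_iff`). No derived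
limit is formed: vanishing of the `lim¹` term is expressed as "a cycle that is a boundary modulo
every truncation is a boundary". Pro-zero systems satisfy this
(`mem_range_of_forall_mem_boxBoundaries`), and pro-vanishing passes from `M` to its direct sums with
the same indices.

Conversely, vanishing of `lim¹` for a countable direct sum of copies of `M` forces the system of `M`
to be Mittag-Leffler: otherwise classes that do not lift, one placed in each summand, give a
contradiction (`boxCycles_mittagLeffler`). A Mittag-Leffler system with zero limit is pro-zero
(`isProZeroBox_of_exact`). As an `R`-module, `M[T]` is such a direct sum, so it suffices as a test
module. -/

theorem koszulSign_mul_self (i : Fin r) (S : Finset (Fin r)) :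
    koszulSign i S * koszulSign i S = 1 := by
  unfold koszulSign
  rw [← mul_pow]; simp

/-- The total Koszul differential of a family of endomorphisms, on families indexed by all
subsets of `{1, …, r}`. -/
noncomputable def kosD (a : Fin r → N →ₗ[R] N) :
    (Finset (Fin r) → N) →ₗ[R] (Finset (Fin r) → N) :=
  LinearMap.pi fun T => ∑ i, if i ∈ T then 0 else
    koszulSign i T • (a i ∘ₗ LinearMap.proj (insert i T))

theorem kosD_apply (a : Fin r → N →ₗ[R] N) (f : Finset (Fin r) → N) (T : Finset (Fin r)) :
    kosD a f T = ∑ i, if i ∈ T then 0 else koszulSign i T • a i (f (insert i T)) := by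
  simp only [kosD, LinearMap.pi_apply, LinearMap.sum_apply]
  refine Finset.sum_congr rfl fun i _ => ?_
  split_ifs <;> simp

/-- The terms for `(i, j)` and `(j, i)` cancel: exchanging the order of insertion flips the sign,
and the operators commute. -/
theorem kosD_kosD (a : Fin r → N →ₗ[R] N) (ha : ∀ i j y, a i (a j y) = a j (a i y))
    (f : Finset (Fin r) → N) : kosD a (kosD a f) = 0 := by
  funext T
  rw [kosD_apply, Pi.zero_apply]
  let F : Fin r → Fin r → N := fun i j =>
    if i ∈ T ∨ j ∈ insert i T then 0 else
      (koszulSign i T * koszulSign j (insert i T)) • a i (a j (f (insert j (insert i T))))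
  refine Eq.trans (Finset.sum_congr rfl fun i _ => ?_)
    (sum_sum_eq_zero_of_alternating F (fun i => by simp [F]) fun i j hij => ?_)
  · by_cases hi : i ∈ T
    · simp [F, hi]
    · rw [if_neg hi, kosD_apply, map_sum, Finset.smul_sum]
      refine Finset.sum_congr rfl fun j _ => ?_
      by_cases hj : j ∈ insert i T
      · simp only [F]
        rw [if_pos hj, if_pos (Or.inr hj), map_zero, smul_zero]
      · simp only [F]
        rw [if_neg hj, if_neg (by tauto), map_zsmul, mul_smul]
  · by_cases h : i ∈ T ∨ j ∈ T
    · have h1 : i ∈ T ∨ j ∈ insert i T := by simp only [Finset.mem_insert]; tauto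
      have h2 : j ∈ T ∨ i ∈ insert j T := by simp only [Finset.mem_insert]; tauto
      simp only [F]
      rw [if_pos h1, if_pos h2, add_zero]
    · push Not at h
      have h1 : ¬ (i ∈ T ∨ j ∈ insert i T) := by
        simp only [Finset.mem_insert, not_or]; exact ⟨h.1, hij.symm, h.2⟩
      have h2 : ¬ (j ∈ T ∨ i ∈ insert j T) := by
        simp only [Finset.mem_insert, not_or]; exact ⟨h.2, hij, h.1⟩
      simp only [F]
      rw [if_neg h1, if_neg h2, koszulSign_insert_swap i j T hij h.1 h.2, ha i j,
        Finset.insert_comm j i, neg_smul, neg_add_cancel]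

/-- The families supported on the subsets with `k` elements. -/
def famDeg (R : Type u) [CommRing R] (r : ℕ) (N : Type v) [AddCommGroup N] [Module R N] (k : ℕ) :
    Submodule R (Finset (Fin r) → N) where
  carrier := {f | ∀ S, S.card ≠ k → f S = 0}
  add_mem' hf hg S hS := by simp [hf S hS, hg S hS]
  zero_mem' S _ := rfl
  smul_mem' c f hf S hS := by simp [hf S hS]

/-- The component in degree `k` of a family. -/
def famTrunc (k : ℕ) (f : Finset (Fin r) → N) : Finset (Fin r) → N :=
  fun S => if S.card = k then f S else 0

theorem famTrunc_mem (k : ℕ) (f : Finset (Fin r) → N) : famTrunc k f ∈ famDeg R r N k :=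
  fun _ hS => if_neg hS

theorem famTrunc_of_mem {k : ℕ} {f : Finset (Fin r) → N} (hf : f ∈ famDeg R r N k) :
    famTrunc k f = f := by
  funext S
  unfold famTrunc
  split_ifs with h
  · rfl
  · exact (hf S h).symm

/-- Homogeneity of the differential. It allows primitives to be sought among all families, without a
degree, and cut down to the right degree afterwards. -/
theorem kosD_famTrunc (a : Fin r → N →ₗ[R] N) (k : ℕ) (f : Finset (Fin r) → N) :
    kosD a (famTrunc (k + 1) f) = famTrunc k (kosD a f) := by
  funext T
  unfold famTrunc
  rw [kosD_apply]
  by_cases hT : T.card = k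
  · rw [if_pos hT, kosD_apply]
    refine Finset.sum_congr rfl fun i _ => ?_
    by_cases hi : i ∈ T
    · rw [if_pos hi, if_pos hi]
    · rw [if_neg hi, if_neg hi, if_pos (by rw [Finset.card_insert_of_notMem hi, hT])]
  · rw [if_neg hT]
    refine Finset.sum_eq_zero fun i _ => ?_
    by_cases hi : i ∈ T
    · rw [if_pos hi]
    · rw [if_neg hi, if_neg (by rw [Finset.card_insert_of_notMem hi]; omega), map_zero, smul_zero]

theorem kosD_mem_famDeg (a : Fin r → N →ₗ[R] N) {k : ℕ} {f : Finset (Fin r) → N}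
    (hf : f ∈ famDeg R r N (k + 1)) : kosD a f ∈ famDeg R r N k := by
  rw [← famTrunc_of_mem hf, kosD_famTrunc]
  exact famTrunc_mem _ _

theorem kosD_eq_zero_of_mem_famDeg_zero (a : Fin r → N →ₗ[R] N) {f : Finset (Fin r) → N}
    (hf : f ∈ famDeg R r N 0) : kosD a f = 0 := by
  funext T
  rw [kosD_apply]
  refine Finset.sum_eq_zero fun i _ => ?_
  split_ifs with hi
  · rfl
  · rw [hf _ (by rw [Finset.card_insert_of_notMem hi]; omega), map_zero, smul_zero]

end KoszulFamilies

/-! ### Power series and their filtration by boxes -/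

section PowerSeries

variable {R : Type u} [CommRing R] {r : ℕ} {X : Type v} [AddCommGroup X] [Module R X]

/-- Families, indexed by the subsets of `{1, …, r}`, of formal power series with coefficients
in `X` in the variables `U_1, …, U_r`. -/
abbrev PowFam (r : ℕ) (X : Type v) : Type v := Finset (Fin r) → (Fin r → ℕ) → X

/-- Multiplication by `x_i - U_i` on power series. -/
noncomputable def subU (x : Fin r → R) (X : Type v) [AddCommGroup X] [Module R X] (i : Fin r) :
    ((Fin r → ℕ) → X) →ₗ[R] ((Fin r → ℕ) → X) where
  toFun g b := x i • g b - if 0 < b i then g (Function.update b i (b i - 1)) else 0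
  map_add' f g := by
    funext b
    simp only [Pi.add_apply]
    split_ifs
    · rw [smul_add]; abel
    · rw [smul_add]; abel
  map_smul' c g := by
    funext b
    simp only [Pi.smul_apply, RingHom.id_apply]
    split_ifs
    · rw [smul_sub, smul_comm]
    · rw [smul_sub, smul_comm, smul_zero]

theorem subU_apply (x : Fin r → R) (i : Fin r) (g : (Fin r → ℕ) → X) (b : Fin r → ℕ) :
    subU x X i g b =
      x i • g b - if 0 < b i then g (Function.update b i (b i - 1)) else 0 := rfl

theorem subU_comm (x : Fin r → R) (i j : Fin r) (g : (Fin r → ℕ) → X) :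
    subU x X i (subU x X j g) = subU x X j (subU x X i g) := by
  by_cases hij : i = j
  · rw [hij]
  funext b
  simp only [subU_apply, Function.update_of_ne hij, Function.update_of_ne (Ne.symm hij),
    Function.update_comm hij]
  split_ifs <;> simp only [smul_sub, smul_comm (x i) (x j), sub_zero]; abel

/-- The differential of `Hom_R(L_x, X)`, on families of power series. -/
noncomputable abbrev cechD (x : Fin r → R) (X : Type v) [AddCommGroup X] [Module R X] :
    PowFam r X →ₗ[R] PowFam r X :=
  kosD (subU x X)

theorem cechD_cechD (x : Fin r → R) (g : PowFam r X) : cechD x X (cechD x X g) = 0 :=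
  kosD_kosD _ (subU_comm x) g

/-- The families of power series all of whose terms of exponent in the box of size `n` vanish. -/
def famFil (R : Type u) [CommRing R] (r : ℕ) (X : Type v) [AddCommGroup X] [Module R X] (n : ℕ) :
    Submodule R (PowFam r X) where
  carrier := {g | ∀ S, ∀ b ∈ expBox r n, g S b = 0}
  add_mem' hf hg S b hb := by simp [hf S b hb, hg S b hb]
  zero_mem' S b _ := rfl
  smul_mem' c f hf S b hb := by simp [hf S b hb]

theorem expBox_mono {m n : ℕ} (h : m ≤ n) : expBox r m ⊆ expBox r n :=
  Fintype.piFinset_subset _ _ fun _ => Finset.range_mono h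

theorem famFil_antitone {m n : ℕ} (h : m ≤ n) : famFil R r X n ≤ famFil R r X m :=
  fun _ hg S b hb => hg S b (expBox_mono h hb)

/-- The sum serves as a bound on all exponents that makes sense for `r = 0` too. -/
theorem mem_expBox_sum (b : Fin r → ℕ) : b ∈ expBox r (∑ i, b i + 1) :=
  mem_expBox.2 fun i => Nat.lt_succ_of_le
    (Finset.single_le_sum (f := b) (fun _ _ => Nat.zero_le _) (Finset.mem_univ i))

theorem update_mem_expBox {n : ℕ} {b : Fin r → ℕ} (hb : b ∈ expBox r n) (i : Fin r) {c : ℕ}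
    (hc : c < n) : Function.update b i c ∈ expBox r n := by
  rw [mem_expBox] at hb ⊢
  intro j
  by_cases hj : j = i
  · subst hj; simpa using hc
  · simpa [hj] using hb j

theorem eq_zero_of_forall_mem_famFil {g : PowFam r X} (h : ∀ n, g ∈ famFil R r X n) : g = 0 := by
  funext S b
  exact h _ S b (mem_expBox_sum b)

theorem subU_eq_zero_of_box (x : Fin r → R) (i : Fin r) {n : ℕ} {g : (Fin r → ℕ) → X}
    (hg : ∀ b ∈ expBox r n, g b = 0) : ∀ b ∈ expBox r n, subU x X i g b = 0 := by
  intro b hb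
  have hi : b i - 1 < n := lt_of_le_of_lt (Nat.sub_le _ _) (mem_expBox.1 hb i)
  rw [subU_apply, hg b hb, hg _ (update_mem_expBox hb i hi)]
  simp

theorem cechD_mem_famFil (x : Fin r → R) {n : ℕ} {g : PowFam r X} (hg : g ∈ famFil R r X n) :
    cechD x X g ∈ famFil R r X n := by
  intro T b hb
  rw [kosD_apply, Finset.sum_apply]
  refine Finset.sum_eq_zero fun i _ => ?_
  split_ifs
  · rfl
  · rw [Pi.smul_apply, subU_eq_zero_of_box x i (hg _) b hb, smul_zero]

theorem famTrunc_mem_famFil {n k : ℕ} {g : PowFam r X} (hg : g ∈ famFil R r X n) :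
    famTrunc k g ∈ famFil R r X n := by
  intro S b hb
  unfold famTrunc
  split_ifs
  · exact hg S b hb
  · rfl

/-- Families of power series are complete for the filtration by boxes. -/
theorem exists_limit {n : ℕ → ℕ} (hn : StrictMono n) (g : ℕ → PowFam r X)
    (hg : ∀ k, g (k + 1) - g k ∈ famFil R r X (n k)) :
    ∃ l : PowFam r X, ∀ k, l - g k ∈ famFil R r X (n k) := by
  have hle : ∀ j k, j ≤ k → g k - g j ∈ famFil R r X (n j) := by
    intro j k hjk
    induction k, hjk using Nat.le_induction with
    | base => rw [sub_self]; exact Submodule.zero_mem _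
    | succ k hk ih =>
      rw [← sub_add_sub_cancel]
      exact Submodule.add_mem _ (famFil_antitone (hn.monotone hk) (hg k)) ih
  -- The coefficient at `b` no longer changes from the term of index `∑ i, b i + 1` on, because `n k
  -- ≥ k`.
  refine ⟨fun S b => g (∑ i, b i + 1) S b, fun k S b hb => ?_⟩
  rcases le_total (∑ i, b i + 1) k with h | h
  · have := hle _ _ h S b (expBox_mono (hn.id_le _) (mem_expBox_sum b))
    rw [Pi.sub_apply, Pi.sub_apply, sub_eq_zero] at this ⊢
    exact this.symm
  · exact hle _ _ h S b hb

end PowerSeries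

/-! ### The division homotopy and normal forms modulo a box -/

section Homotopy

variable {R : Type u} [CommRing R] {r : ℕ} {X : Type v} [AddCommGroup X] [Module R X]

theorem sum_Ioo_sub_pred {A : Type*} [AddCommGroup A] (G : ℕ → A) {a n : ℕ} (h : a < n) :
    ∑ c ∈ Finset.Ioo a n, (G c - G (c - 1)) = G (n - 1) - G a := by
  induction n, h using Nat.le_induction with
  | base =>
    rw [Finset.sum_eq_zero]
    · simp
    · intro c hc
      rw [Finset.mem_Ioo] at hc
      omega
  | succ n hn ih =>
    have : Finset.Ioo a (n + 1) = insert n (Finset.Ioo a n) := by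
      ext c
      simp only [Finset.mem_Ioo, Finset.mem_insert]
      omega
    rw [this, Finset.sum_insert (by simp), ih, Nat.add_sub_cancel]
    abel

/-- The quotient of a power series, truncated at `U_i ^ n`, by `U_i - x_i`, up to sign. -/
noncomputable def divU (x : Fin r → R) (X : Type v) [AddCommGroup X] [Module R X] (n : ℕ)
    (i : Fin r) : ((Fin r → ℕ) → X) →ₗ[R] ((Fin r → ℕ) → X) where
  -- From `(U^c - x^c) / (U - x) = ∑_{b<c} x^(c-1-b) U^b`; the sign turns `U - x` into `x - U`.
  toFun g b := -∑ c ∈ Finset.Ioo (b i) n, x i ^ (c - 1 - b i) • g (Function.update b i c)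
  map_add' f g := by
    funext b
    simp only [Pi.add_apply, smul_add, Finset.sum_add_distrib, neg_add]
  map_smul' c g := by
    funext b
    simp only [Pi.smul_apply, RingHom.id_apply, smul_neg, Finset.smul_sum]
    congr 1
    exact Finset.sum_congr rfl fun _ _ => smul_comm _ _ _

theorem divU_apply (x : Fin r → R) (n : ℕ) (i : Fin r) (g : (Fin r → ℕ) → X) (b : Fin r → ℕ) :
    divU x X n i g b =
      -∑ c ∈ Finset.Ioo (b i) n, x i ^ (c - 1 - b i) • g (Function.update b i c) := rfl

theorem divU_subU_comm (x : Fin r → R) (n : ℕ) {i j : Fin r} (hij : i ≠ j)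
    (g : (Fin r → ℕ) → X) :
    divU x X n i (subU x X j g) = subU x X j (divU x X n i g) := by
  funext b
  simp only [divU_apply, subU_apply, Function.update_of_ne hij, Function.update_of_ne hij.symm,
    Function.update_comm hij]
  split_ifs with h
  · simp only [smul_sub, Finset.sum_sub_distrib, smul_neg, Finset.smul_sum, smul_comm (x j)]
    abel
  · simp only [sub_zero, smul_neg, Finset.smul_sum, smul_comm (x j)]

/-- Multiplying the quotient back recovers `g` minus its remainder, the value at `U_i = x_i`, which
is constant in `U_i`; hence the restriction to positive exponents. -/
theorem subU_divU (x : Fin r → R) {n : ℕ} (i : Fin r) (g : (Fin r → ℕ) → X) {b : Fin r → ℕ}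
    (hb : b ∈ expBox r n) (hi : 0 < b i) : subU x X i (divU x X n i g) b = g b := by
  have hlt := mem_expBox.1 hb i
  have hI : Finset.Ioo (b i - 1) n = insert (b i) (Finset.Ioo (b i) n) := by
    ext c
    simp only [Finset.mem_Ioo, Finset.mem_insert]
    omega
  rw [subU_apply, if_pos hi, divU_apply, divU_apply]
  simp only [Function.update_self, Function.update_idem]
  rw [hI, Finset.sum_insert (by simp), Function.update_eq_self, Nat.sub_self, pow_zero, one_smul,
    smul_neg, Finset.smul_sum]
  have : ∑ c ∈ Finset.Ioo (b i) n, x i • x i ^ (c - 1 - b i) • g (Function.update b i c) =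
      ∑ c ∈ Finset.Ioo (b i) n, x i ^ (c - 1 - (b i - 1)) • g (Function.update b i c) := by
    refine Finset.sum_congr rfl fun c hc => ?_
    rw [Finset.mem_Ioo] at hc
    rw [smul_smul, ← pow_succ']
    congr 2
    omega
  rw [this]
  abel

/-- The sum telescopes. Truncation leaves an error, the coefficient of `U_i^(n-1)` times `∑_b
x_i^(n-1-b) U_i^b`, which is the degree 1 generator of the comparison with `x_i^n`. -/
theorem divU_subU (x : Fin r → R) {n : ℕ} (i : Fin r) (g : (Fin r → ℕ) → X) {b : Fin r → ℕ}
    (hb : b ∈ expBox r n) :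
    divU x X n i (subU x X i g) b =
      g b - x i ^ (n - 1 - b i) • g (Function.update b i (n - 1)) := by
  have hlt := mem_expBox.1 hb i
  let G : ℕ → X := fun c => x i ^ (c - b i) • g (Function.update b i c)
  have : ∀ c ∈ Finset.Ioo (b i) n,
      x i ^ (c - 1 - b i) • subU x X i g (Function.update b i c) = G c - G (c - 1) := by
    intro c hc
    rw [Finset.mem_Ioo] at hc
    rw [subU_apply, Function.update_self, if_pos (by omega), Function.update_idem, smul_sub,
      smul_smul, ← pow_succ]
    simp only [G]
    congr 3
    omega
  rw [divU_apply, Finset.sum_congr rfl this, sum_Ioo_sub_pred G hlt]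
  simp [G]

theorem divU_eq_zero_of_box (x : Fin r → R) (i : Fin r) {n : ℕ} {g : (Fin r → ℕ) → X}
    (hg : ∀ b ∈ expBox r n, 0 < b i → g b = 0) : ∀ b ∈ expBox r n, divU x X n i g b = 0 := by
  intro b hb
  rw [divU_apply, Finset.sum_eq_zero, neg_zero]
  intro c hc
  rw [Finset.mem_Ioo] at hc
  rw [hg _ (update_mem_expBox hb i hc.2) (by rw [Function.update_self]; omega), smul_zero]

/-- The contracting homotopy in the direction of the variable `U_i`. -/
noncomputable def famHomotopy (x : Fin r → R) (n : ℕ) (i : Fin r) (w : PowFam r X) : PowFam r X :=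
  fun S => if i ∈ S then koszulSign i (S.erase i) • divU x X n i (w (S.erase i)) else 0

theorem famHomotopy_of_mem (x : Fin r → R) (n : ℕ) {i : Fin r} (w : PowFam r X)
    {S : Finset (Fin r)} (h : i ∈ S) : famHomotopy x n i w S =
      koszulSign i (S.erase i) • divU x X n i (w (S.erase i)) := if_pos h

theorem famHomotopy_of_notMem (x : Fin r → R) (n : ℕ) {i : Fin r} (w : PowFam r X)
    {S : Finset (Fin r)} (h : i ∉ S) : famHomotopy x n i w S = 0 := if_neg h

/-- The families that agree, in the box of size `n`, with an element of the Koszul complex of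
`x_i ^ n` in the direction of the variable `U_i`. -/
def famStd (x : Fin r → R) (X : Type v) [AddCommGroup X] [Module R X] (n : ℕ) (i : Fin r) :
    Submodule R (PowFam r X) where
  carrier := {g | ∀ S, ∀ b ∈ expBox r n, (i ∉ S → 0 < b i → g S b = 0) ∧
    (i ∈ S → g S b = x i ^ (n - 1 - b i) • g S (Function.update b i (n - 1)))}
  add_mem' {f g} hf hg S b hb := by
    refine ⟨fun h h' => ?_, fun h => ?_⟩
    · simp [(hf S b hb).1 h h', (hg S b hb).1 h h']
    · rw [Pi.add_apply, Pi.add_apply, (hf S b hb).2 h, (hg S b hb).2 h, ← smul_add]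
      rfl
  zero_mem' S b _ := ⟨fun _ _ => rfl, fun _ => (smul_zero _).symm⟩
  smul_mem' c f hf S b hb := by
    refine ⟨fun h h' => ?_, fun h => ?_⟩
    · simp [(hf S b hb).1 h h']
    · rw [Pi.smul_apply, Pi.smul_apply, (hf S b hb).2 h, smul_comm]
      rfl

theorem famFil_le_famStd (x : Fin r → R) (n : ℕ) (i : Fin r) :
    famFil R r X n ≤ famStd x X n i := by
  intro g hg S b hb
  refine ⟨fun _ _ => hg S b hb, fun _ => ?_⟩
  have hn : n - 1 < n := by have := mem_expBox.1 hb i; omega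
  rw [hg S b hb, hg S _ (update_mem_expBox hb i hn), smul_zero]

/-- The homotopy only reads components without `i` at positive exponents of `U_i`, and inside the
box these vanish for standard families. -/
theorem famHomotopy_mem_famFil (x : Fin r → R) {n : ℕ} {i : Fin r} {g : PowFam r X}
    (hg : g ∈ famStd x X n i) : famHomotopy x n i g ∈ famFil R r X n := by
  intro S b hb
  by_cases hi : i ∈ S
  · rw [famHomotopy_of_mem x n g hi, Pi.smul_apply, divU_eq_zero_of_box x i _ b hb, smul_zero]
    intro c hc h
    exact (hg _ c hc).1 (Finset.notMem_erase i S) h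
  · rw [famHomotopy_of_notMem x n g hi]; rfl

/-- Being standard is inherited along maps that do not involve the variable. -/
theorem divU_std (x : Fin r → R) {n : ℕ} {i j : Fin r} (hij : i ≠ j) {g : (Fin r → ℕ) → X} :
    ((∀ b ∈ expBox r n, 0 < b j → g b = 0) →
      ∀ b ∈ expBox r n, 0 < b j → divU x X n i g b = 0) ∧
    ((∀ b ∈ expBox r n, g b = x j ^ (n - 1 - b j) • g (Function.update b j (n - 1))) →
      ∀ b ∈ expBox r n, divU x X n i g b =
        x j ^ (n - 1 - b j) • divU x X n i g (Function.update b j (n - 1))) := by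
  refine ⟨fun hg b hb h => ?_, fun hg b hb => ?_⟩
  · rw [divU_apply, Finset.sum_eq_zero, neg_zero]
    intro c hc
    rw [Finset.mem_Ioo] at hc
    rw [hg _ (update_mem_expBox hb i hc.2) (by rwa [Function.update_of_ne hij.symm]), smul_zero]
  · rw [divU_apply, divU_apply, smul_neg, Finset.smul_sum, Function.update_of_ne hij]
    congr 1
    refine Finset.sum_congr rfl fun c hc => ?_
    rw [Finset.mem_Ioo] at hc
    rw [hg _ (update_mem_expBox hb i hc.2), Function.update_of_ne hij.symm,
      Function.update_comm hij, smul_comm]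

theorem subU_std (x : Fin r → R) {n : ℕ} {i j : Fin r} (hij : i ≠ j) {g : (Fin r → ℕ) → X} :
    ((∀ b ∈ expBox r n, 0 < b j → g b = 0) →
      ∀ b ∈ expBox r n, 0 < b j → subU x X i g b = 0) ∧
    ((∀ b ∈ expBox r n, g b = x j ^ (n - 1 - b j) • g (Function.update b j (n - 1))) →
      ∀ b ∈ expBox r n, subU x X i g b =
        x j ^ (n - 1 - b j) • subU x X i g (Function.update b j (n - 1))) := by
  have hlt : ∀ b ∈ expBox r n, b i - 1 < n := fun b hb =>
    lt_of_le_of_lt (Nat.sub_le _ _) (mem_expBox.1 hb i)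
  refine ⟨fun hg b hb h => ?_, fun hg b hb => ?_⟩
  · rw [subU_apply, hg b hb h, hg _ (update_mem_expBox hb i (hlt b hb))
      (by rwa [Function.update_of_ne hij.symm])]
    simp
  · rw [subU_apply, subU_apply, hg b hb, Function.update_of_ne hij, Function.update_comm hij.symm,
      hg _ (update_mem_expBox hb i (hlt b hb)), Function.update_of_ne hij.symm, smul_sub,
      smul_comm (x i), Function.update_comm hij]
    split_ifs
    · rfl
    · rw [smul_zero]

/-- Normalising in direction `i` does not spoil a direction `j` treated earlier. -/
theorem famHomotopy_mem_famStd (x : Fin r → R) {n : ℕ} {i j : Fin r} (hij : i ≠ j)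
    {g : PowFam r X} (hg : g ∈ famStd x X n j) : famHomotopy x n i g ∈ famStd x X n j := by
  intro S b hb
  by_cases hi : i ∈ S
  · rw [famHomotopy_of_mem x n g hi]
    refine ⟨fun h h' => ?_, fun h => ?_⟩
    · rw [Pi.smul_apply, (divU_std x hij).1 _ b hb h', smul_zero]
      exact fun c hc hj => (hg _ c hc).1 (by simp [h]) hj
    · rw [Pi.smul_apply, Pi.smul_apply, (divU_std x hij).2 _ b hb, smul_comm]
      exact fun c hc => (hg _ c hc).2 (by simp [h, hij.symm])
  · rw [famHomotopy_of_notMem x n g hi]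
    exact ⟨fun _ _ => rfl, fun _ => (smul_zero _).symm⟩

/-- Only the summand in direction `j` itself needs an argument: there `x_j - U_j` takes `∑_b
x_j^(n-1-b) U_j^b` to `x_j^n - U_j^n`, which has no positive exponent below `n`. -/
theorem cechD_mem_famStd (x : Fin r → R) {n : ℕ} {j : Fin r} {g : PowFam r X}
    (hg : g ∈ famStd x X n j) : cechD x X g ∈ famStd x X n j := by
  intro S b hb
  simp only [kosD_apply, Finset.sum_apply]
  refine ⟨fun h h' => Finset.sum_eq_zero fun i _ => ?_, fun h => ?_⟩
  · split_ifs with hi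
    · rfl
    by_cases hij : i = j
    · subst hij
      have hlt := mem_expBox.1 hb i
      have hb' := update_mem_expBox hb i (c := b i - 1) (by omega)
      rw [Pi.smul_apply, subU_apply, (hg _ b hb).2 (by simp), if_pos h', (hg _ _ hb').2 (by simp),
        Function.update_self, Function.update_idem, smul_smul, ← pow_succ',
        show n - 1 - b i + 1 = n - 1 - (b i - 1) by omega, sub_self, smul_zero]
    · rw [Pi.smul_apply, (subU_std x hij).1 _ b hb h', smul_zero]
      exact fun c hc hj => (hg _ c hc).1 (by simp [h, Ne.symm hij]) hj
  · rw [Finset.smul_sum]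
    refine Finset.sum_congr rfl fun i _ => ?_
    split_ifs with hi
    · exact (smul_zero _).symm
    have hij : i ≠ j := fun e => hi (e ▸ h)
    rw [Pi.smul_apply, Pi.smul_apply, (subU_std x hij).2 _ b hb, smul_comm]
    exact fun c hc => (hg _ c hc).2 (by simp [h])

/-- In `dh + hd` the directions `j ≠ i` cancel by anticommutation of signs. Direction `i` leaves
multiplication after division or division after multiplication, according to whether `i` is in the
index set, and the two remainders are exactly the standard shapes. -/
theorem sub_homotopy_mem_famStd (x : Fin r → R) (n : ℕ) (i : Fin r) (w : PowFam r X) :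
    w - cechD x X (famHomotopy x n i w) - famHomotopy x n i (cechD x X w) ∈ famStd x X n i := by
  intro T b hb
  have hn : n - 1 < n := by have := mem_expBox.1 hb i; omega
  constructor
  · intro hi h
    have h1 : cechD x X (famHomotopy x n i w) T = subU x X i (divU x X n i (w T)) := by
      rw [kosD_apply, Finset.sum_eq_single i]
      · rw [if_neg hi, famHomotopy_of_mem x n w (Finset.mem_insert_self i T),
          Finset.erase_insert hi, map_zsmul, smul_smul, koszulSign_mul_self, one_smul]
      · intro j _ hj
        rw [famHomotopy_of_notMem x n w (by simp [hi, Ne.symm hj]), map_zero, smul_zero, ite_self]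
      · simp
    rw [Pi.sub_apply, Pi.sub_apply w, h1, famHomotopy_of_notMem x n _ hi, sub_zero, Pi.sub_apply,
      subU_divU x i _ hb h, sub_self]
  · intro hi
    have h1 : cechD x X (famHomotopy x n i w) T + famHomotopy x n i (cechD x X w) T =
        divU x X n i (subU x X i (w T)) := by
      rw [famHomotopy_of_mem x n _ hi, kosD_apply, kosD_apply, map_sum, Finset.smul_sum,
        ← Finset.sum_add_distrib, Finset.sum_eq_single i]
      · rw [if_pos hi, if_neg (Finset.notMem_erase i T), Finset.insert_erase hi, map_zsmul,
          smul_smul, koszulSign_mul_self, one_smul, zero_add]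
      · intro j _ hj
        by_cases hjT : j ∈ T
        · rw [if_pos hjT, if_pos (by simp [hj, hjT]), map_zero, smul_zero, add_zero]
        · have hjE : j ∉ T.erase i := fun h => hjT (Finset.mem_of_mem_erase h)
          have hE : (insert j T).erase i = insert j (T.erase i) :=
            Finset.erase_insert_of_ne hj
          have hs := koszulSign_insert_swap i j (T.erase i) hj.symm (Finset.notMem_erase i T) hjE
          rw [Finset.insert_erase hi] at hs
          rw [if_neg hjT, if_neg hjE, famHomotopy_of_mem x n w (Finset.mem_insert_of_mem hi), hE,
            map_zsmul, map_zsmul, divU_subU_comm x n hj.symm, smul_smul, smul_smul, ← add_smul]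
          convert zero_smul ℤ _ using 2
          have e1 := koszulSign_mul_self i (T.erase i)
          have e4 := koszulSign_mul_self i (insert j (T.erase i))
          -- The swap relation `hs`, multiplied by the signs needed to isolate the two terms; `e1`
          -- and `e4` remove squares of signs.
          linear_combination
            (koszulSign i (insert j (T.erase i)) * koszulSign i (T.erase i)) * hs
            - koszulSign j T * koszulSign i (insert j (T.erase i)) * e1
            - koszulSign i (T.erase i) * koszulSign j (T.erase i) * e4
      · simp
    rw [sub_sub, Pi.sub_apply, Pi.add_apply, h1]
    simp only [Pi.sub_apply]
    rw [divU_subU x i _ hb, divU_subU x i _ (update_mem_expBox hb i hn), Function.update_self,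
      Function.update_idem, Nat.sub_self, pow_zero, one_smul]
    simp

/-- Any family whose differential is standard can be made standard, modulo boundaries. -/
theorem exists_std (x : Fin r → R) (n : ℕ) (w : PowFam r X)
    (hw : ∀ i, cechD x X w ∈ famStd x X n i) :
    ∃ v : PowFam r X, w - cechD x X v ∈ ⨅ i, famStd x X n i := by
  -- The variables are normalised one at a time; `A` is the set of directions already treated.
  suffices h : ∀ A : Finset (Fin r), ∃ v : PowFam r X,
      ∀ i ∈ A, w - cechD x X v ∈ famStd x X n i by
    obtain ⟨v, hv⟩ := h Finset.univ
    exact ⟨v, Submodule.mem_iInf _ |>.2 fun i => hv i (Finset.mem_univ i)⟩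
  intro A
  induction A using Finset.induction_on with
  | empty => exact ⟨0, fun i hi => absurd hi (Finset.notMem_empty i)⟩
  | insert i A hi ih =>
    obtain ⟨v, hv⟩ := ih
    have hD : cechD x X (w - cechD x X v) = cechD x X w := by
      rw [map_sub, cechD_cechD, sub_zero]
    refine ⟨v + famHomotopy x n i (w - cechD x X v), fun j hj => ?_⟩
    rw [map_add, ← sub_sub]
    by_cases hji : j = i
    · subst hji
      have h1 := sub_homotopy_mem_famStd x n j (w - cechD x X v)
      rw [hD] at h1
      -- `w` need not be a cycle; the extra term `h(dw)` is harmless because it vanishes on the box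
      -- when `dw` is standard.
      rw [← sub_add_cancel (_ - cechD x X (famHomotopy x n j _)) (famHomotopy x n j (cechD x X w))]
      exact Submodule.add_mem _ h1 (famFil_le_famStd x n j (famHomotopy_mem_famFil x (hw j)))
    · have := hv j (Finset.mem_of_mem_insert_of_ne hj hji)
      exact Submodule.sub_mem _ this
        (cechD_mem_famStd x (famHomotopy_mem_famStd x (Ne.symm hji) this))

end Homotopy

/-! ### Truncated power series versus Koszul complexes of powers -/

section Comparison

variable {R : Type u} [CommRing R] {r : ℕ} {X : Type v} [AddCommGroup X] [Module R X]

/-- The total Koszul differential of the sequence `x_1 ^ n, …, x_r ^ n`. -/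
noncomputable abbrev powD (x : Fin r → R) (X : Type v) [AddCommGroup X] [Module R X] (n : ℕ) :
    (Finset (Fin r) → X) →ₗ[R] (Finset (Fin r) → X) :=
  kosD fun i => x i ^ n • LinearMap.id

/-- The transition map between the Koszul complexes of powers, on families. -/
def famPow (x : Fin r → R) (m n : ℕ) (f : Finset (Fin r) → X) : Finset (Fin r) → X :=
  fun S => (∏ i ∈ S, x i ^ (m - n)) • f S

/-- The coefficients of the comparison map from the Koszul complex of `x_1 ^ n, …, x_r ^ n` to
families of power series. -/
def stdCoeff (x : Fin r → R) (n : ℕ) (S : Finset (Fin r)) (b : Fin r → ℕ) : R :=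
  ∏ i, if i ∈ S then x i ^ (n - 1 - b i) else if b i = 0 then 1 else 0

/-- The comparison map from the Koszul complex of `x_1 ^ n, …, x_r ^ n` to families of power
series. -/
def famIota (x : Fin r → R) (X : Type v) [AddCommGroup X] [Module R X] (n : ℕ) :
    (Finset (Fin r) → X) →ₗ[R] PowFam r X where
  toFun f S b := stdCoeff x n S b • f S
  map_add' f g := by funext S b; simp
  map_smul' c f := by funext S b; exact smul_comm _ _ _

theorem famIota_apply (x : Fin r → R) (n : ℕ) (f : Finset (Fin r) → X) (S : Finset (Fin r))
    (b : Fin r → ℕ) : famIota x X n f S b = stdCoeff x n S b • f S := rfl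

theorem famIota_famTrunc (x : Fin r → R) (n k : ℕ) (f : Finset (Fin r) → X) :
    famIota x X n (famTrunc k f) = famTrunc k (famIota x X n f) := by
  funext S b
  simp only [famIota_apply, famTrunc]
  split_ifs
  · rfl
  · rw [smul_zero]; rfl

theorem famIota_mem_famDeg (x : Fin r → R) (n : ℕ) {k : ℕ} {f : Finset (Fin r) → X}
    (hf : f ∈ famDeg R r X k) : famIota x X n f ∈ famDeg R r _ k := by
  rw [← famTrunc_of_mem hf, famIota_famTrunc]
  exact famTrunc_mem _ _

/-- The exponent in the box of size `n` at which the coefficient of the comparison map is `1`. -/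
def boxCorner (n : ℕ) (S : Finset (Fin r)) : Fin r → ℕ := fun i => if i ∈ S then n - 1 else 0

theorem boxCorner_mem {n : ℕ} (hn : 0 < n) (S : Finset (Fin r)) :
    boxCorner n S ∈ expBox r n := by
  rw [mem_expBox]
  intro i
  unfold boxCorner
  split_ifs <;> omega

theorem stdCoeff_boxCorner (x : Fin r → R) (n : ℕ) (S : Finset (Fin r)) :
    stdCoeff x n S (boxCorner n S) = 1 := by
  unfold stdCoeff boxCorner
  refine Finset.prod_eq_one fun i _ => ?_
  by_cases hi : i ∈ S <;> simp [hi]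

/-- `f S` can be read off at the corner of the box, so the comparison is injective even after
truncation; an empty box would have no corner. -/
theorem eq_zero_of_famIota_mem {x : Fin r → R} {n : ℕ} (hn : 0 < n) {f : Finset (Fin r) → X}
    (hf : famIota x X n f ∈ famFil R r X n) : f = 0 := by
  funext S
  have := hf S _ (boxCorner_mem hn S)
  rwa [famIota_apply, stdCoeff_boxCorner, one_smul] at this

theorem famIota_mem_famStd (x : Fin r → R) (n : ℕ) (f : Finset (Fin r) → X) (j : Fin r) :
    famIota x X n f ∈ famStd x X n j := by
  intro S b hb
  simp only [famIota_apply]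
  refine ⟨fun hj h => ?_, fun hj => ?_⟩
  · rw [stdCoeff, Finset.prod_eq_zero (Finset.mem_univ j), zero_smul]
    rw [if_neg hj, if_neg h.ne']
  · rw [smul_smul]
    congr 1
    unfold stdCoeff
    rw [← Finset.mul_prod_erase _ _ (Finset.mem_univ j),
      ← Finset.mul_prod_erase Finset.univ _ (Finset.mem_univ j), if_pos hj, if_pos hj,
      Function.update_self, Nat.sub_self, pow_zero, one_mul]
    congr 1
    refine Finset.prod_congr rfl fun i hi => ?_
    rw [Function.update_of_ne (Finset.ne_of_mem_erase hi)]

/-- A standard family is determined on the box by its corner coefficients: moving one coordinate of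
the exponent to the corner costs one factor of `stdCoeff`. -/
theorem sub_famIota_mem_famFil {x : Fin r → R} {n : ℕ} (hn : 0 < n) {g : PowFam r X}
    (hg : g ∈ ⨅ i, famStd x X n i) :
    g - famIota x X n (fun S => g S (boxCorner n S)) ∈ famFil R r X n := by
  rw [Submodule.mem_iInf] at hg
  intro S b hb
  rw [Pi.sub_apply, Pi.sub_apply, famIota_apply, sub_eq_zero]
  have key : ∀ A : Finset (Fin r), g S b =
      (∏ i ∈ A, if i ∈ S then x i ^ (n - 1 - b i) else if b i = 0 then 1 else 0) •
        g S (A.piecewise (boxCorner n S) b) := by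
    intro A
    induction A using Finset.induction_on with
    | empty => simp
    | insert i A hi ih =>
      have hbA : A.piecewise (boxCorner n S) b ∈ expBox r n := by
        rw [mem_expBox]
        intro j
        by_cases hj : j ∈ A
        · rw [Finset.piecewise_eq_of_mem _ _ _ hj]
          exact mem_expBox.1 (boxCorner_mem hn S) j
        · rw [Finset.piecewise_eq_of_notMem _ _ _ hj]
          exact mem_expBox.1 hb j
      have hbi : A.piecewise (boxCorner n S) b i = b i :=
        Finset.piecewise_eq_of_notMem _ _ _ hi
      have h1 := hg i S _ hbA
      rw [hbi] at h1
      rw [ih, Finset.prod_insert hi, Finset.piecewise_insert, mul_comm, mul_smul]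
      congr 1
      by_cases hiS : i ∈ S
      · rw [if_pos hiS, h1.2 hiS]
        simp only [boxCorner, if_pos hiS]
      · rw [if_neg hiS]
        by_cases hb0 : b i = 0
        · rw [if_pos hb0, one_smul]
          simp only [boxCorner, if_neg hiS]
          rw [← hb0, ← hbi, Function.update_eq_self]
        · rw [if_neg hb0, zero_smul, h1.1 hiS (Nat.pos_of_ne_zero hb0)]
  have := key Finset.univ
  rwa [Finset.piecewise_univ] at this

/-- The identity `(x - U) ∑_b x^(n-1-b) U^b = x^n - U^n` in the variable `U_i`, inside the box; the
other variables contribute a common factor. -/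
theorem subU_stdCoeff (x : Fin r → R) {n : ℕ} {T : Finset (Fin r)} {i : Fin r} (hi : i ∉ T)
    {b : Fin r → ℕ} (hb : b ∈ expBox r n) :
    (x i * stdCoeff x n (insert i T) b - if 0 < b i then
      stdCoeff x n (insert i T) (Function.update b i (b i - 1)) else 0) =
      stdCoeff x n T b * x i ^ n := by
  have hlt := mem_expBox.1 hb i
  have h1 : ∀ S : Finset (Fin r), S.erase i = T.erase i → ∀ c : ℕ,
      stdCoeff x n S (Function.update b i c) =
        (if i ∈ S then x i ^ (n - 1 - c) else if c = 0 then 1 else 0) *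
        ∏ j ∈ Finset.univ.erase i,
          if j ∈ T then x j ^ (n - 1 - b j) else if b j = 0 then 1 else 0 := by
    intro S hS c
    unfold stdCoeff
    rw [← Finset.mul_prod_erase _ _ (Finset.mem_univ i), Function.update_self]
    congr 1
    refine Finset.prod_congr rfl fun j hj => ?_
    have hne := Finset.ne_of_mem_erase hj
    have : j ∈ S ↔ j ∈ T := by
      have := Finset.ext_iff.1 hS j
      simpa [hne] using this
    simp only [Function.update_of_ne hne, this]
  have h2 := h1 T rfl (b i)
  have h3 := h1 (insert i T) (by rw [Finset.erase_insert_eq_erase]) (b i)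
  have h4 := h1 (insert i T) (by rw [Finset.erase_insert_eq_erase]) (b i - 1)
  rw [Function.update_eq_self] at h2 h3
  rw [h2, h3, h4, if_neg hi, if_pos (Finset.mem_insert_self i T),
    if_pos (Finset.mem_insert_self i T), ← mul_assoc, ← pow_succ']
  by_cases h0 : b i = 0
  · rw [if_neg (by omega), if_pos h0, sub_zero, one_mul, mul_comm]
    congr 2
    omega
  · rw [if_pos (by omega), if_neg h0, zero_mul, zero_mul,
      show n - 1 - b i + 1 = n - 1 - (b i - 1) by omega, sub_self]

/-- The comparison is a chain map only modulo the box: outside it the truncated subtraction in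
`stdCoeff` gives irrelevant values. -/
theorem cechD_famIota (x : Fin r → R) (n : ℕ) (f : Finset (Fin r) → X) :
    cechD x X (famIota x X n f) - famIota x X n (powD x X n f) ∈ famFil R r X n := by
  intro T b hb
  rw [Pi.sub_apply, Pi.sub_apply, sub_eq_zero, famIota_apply, kosD_apply, kosD_apply,
    Finset.sum_apply, Finset.smul_sum]
  refine Finset.sum_congr rfl fun i _ => ?_
  split_ifs with hi
  · exact (smul_zero _).symm
  · rw [Pi.smul_apply, smul_comm (stdCoeff x n T b)]
    congr 1
    rw [LinearMap.smul_apply, LinearMap.id_apply, smul_smul, ← subU_stdCoeff x hi hb, subU_apply,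
      famIota_apply, famIota_apply, sub_smul, mul_smul]
    congr 1
    split_ifs
    · rfl
    · rw [zero_smul]

/-- Since `x^(m-1-b) = x^(n-1-b) x^(m-n)` for `b < n`, shrinking the box corresponds to the Koszul
transition map. -/
theorem famIota_famPow (x : Fin r → R) {m n : ℕ} (h : n ≤ m) (f : Finset (Fin r) → X) :
    famIota x X m f - famIota x X n (famPow x m n f) ∈ famFil R r X n := by
  intro S b hb
  rw [Pi.sub_apply, Pi.sub_apply, sub_eq_zero, famIota_apply, famIota_apply, famPow, smul_smul]
  congr 1
  unfold stdCoeff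
  rw [← Finset.univ_inter S, ← Finset.prod_ite_mem Finset.univ S, Finset.univ_inter,
    ← Finset.prod_mul_distrib]
  refine Finset.prod_congr rfl fun i _ => ?_
  have := mem_expBox.1 hb i
  split_ifs
  · rw [← pow_add]
    congr 1
    omega
  · rw [mul_one]
  · rw [mul_one]

/-- The cycles of degree `k` modulo the families vanishing on the box of size `n`. -/
noncomputable def boxCycles (x : Fin r → R) (X : Type v) [AddCommGroup X] [Module R X]
    (k n : ℕ) : Submodule R (PowFam r X) :=
  famDeg R r _ k ⊓ (famFil R r X n).comap (cechD x X)

/-- The boundaries modulo the families vanishing on the box of size `n`. -/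
noncomputable def boxBoundaries (x : Fin r → R) (X : Type v) [AddCommGroup X] [Module R X]
    (n : ℕ) : Submodule R (PowFam r X) :=
  LinearMap.range (cechD x X) ⊔ famFil R r X n

theorem mem_boxCycles {x : Fin r → R} {k n : ℕ} {g : PowFam r X} :
    g ∈ boxCycles x X k n ↔ g ∈ famDeg R r _ k ∧ cechD x X g ∈ famFil R r X n := Iff.rfl

theorem mem_boxBoundaries {x : Fin r → R} {n : ℕ} {g : PowFam r X} :
    g ∈ boxBoundaries x X n ↔ ∃ w, g - cechD x X w ∈ famFil R r X n := by
  unfold boxBoundaries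
  rw [Submodule.mem_sup]
  constructor
  · rintro ⟨_, ⟨w, rfl⟩, z, hz, rfl⟩
    exact ⟨w, by rwa [add_sub_cancel_left]⟩
  · rintro ⟨w, hw⟩
    exact ⟨_, ⟨w, rfl⟩, _, hw, add_sub_cancel _ _⟩

theorem boxBoundaries_antitone (x : Fin r → R) {m n : ℕ} (h : m ≤ n) :
    boxBoundaries x X n ≤ boxBoundaries x X m :=
  sup_le_sup_left (famFil_antitone h) _

theorem boxCycles_antitone (x : Fin r → R) (k : ℕ) {m n : ℕ} (h : m ≤ n) :
    boxCycles x X k n ≤ boxCycles x X k m :=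
  inf_le_inf_left _ (Submodule.comap_mono (famFil_antitone h))

/-- Surjectivity of the comparison on homology: subtracting a boundary makes a truncated cycle
standard, and its corner coefficients then form a Koszul cycle. -/
theorem exists_famIota (x : Fin r → R) {k m : ℕ} (hm : 0 < m) {g : PowFam r X}
    (hg : g ∈ boxCycles x X k m) :
    ∃ f ∈ famDeg R r X k, powD x X m f = 0 ∧ ∃ v, g - cechD x X v - famIota x X m f ∈
      famFil R r X m := by
  obtain ⟨v, hv⟩ := exists_std x m g fun i => famFil_le_famStd x m i hg.2
  have h1 := sub_famIota_mem_famFil hm hv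
  set f0 : Finset (Fin r) → X := fun S => (g - cechD x X v) S (boxCorner m S)
  have h2 : g - cechD x X (famTrunc (k + 1) v) - famIota x X m (famTrunc k f0) ∈
      famFil R r X m := by
    have h3 : g - cechD x X (famTrunc (k + 1) v) - famIota x X m (famTrunc k f0) =
        famTrunc k (g - cechD x X v - famIota x X m f0) := by
      nth_rewrite 1 [← famTrunc_of_mem hg.1]
      rw [kosD_famTrunc, famIota_famTrunc]
      funext S
      simp only [famTrunc, Pi.sub_apply]
      split_ifs
      · rfl
      · simp
    rw [h3]
    exact famTrunc_mem_famFil h1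
  refine ⟨famTrunc k f0, famTrunc_mem _ _, eq_zero_of_famIota_mem hm (x := x) ?_, _, h2⟩
  have h4 := cechD_mem_famFil x h2
  rw [map_sub, map_sub, cechD_cechD, sub_zero] at h4
  have h5 := cechD_famIota x m (famTrunc k f0)
  have := Submodule.sub_mem _ (Submodule.sub_mem _ (mem_boxCycles.1 hg).2 h4) h5
  simpa using this

/-- A transition map that vanishes on Koszul homology vanishes on the homology of truncated
power series. -/
theorem boxCycles_le_boxBoundaries (x : Fin r → R) {k m n : ℕ} (hn : 0 < n) (hnm : n ≤ m)
    (h : ∀ f ∈ famDeg R r X k, powD x X m f = 0 → ∃ w, powD x X n w = famPow x m n f) :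
    boxCycles x X k m ≤ boxBoundaries x X n := by
  intro g hg
  obtain ⟨f, hf, hf0, v, hv⟩ := exists_famIota x (hn.trans_le hnm) hg
  obtain ⟨w, hw⟩ := h f hf hf0
  rw [mem_boxBoundaries]
  refine ⟨v + famIota x X n w, ?_⟩
  have h1 := famIota_famPow x hnm f
  rw [← hw] at h1
  have := Submodule.sub_mem _ (Submodule.add_mem _ (famFil_antitone hnm hv) h1)
    (cechD_famIota x n w)
  rw [map_add]
  convert this using 1
  abel

/-- Injectivity of the comparison on homology: a primitive of a standard family can be made standard
without changing its differential, and its corner coefficients are a Koszul primitive. -/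
theorem exists_powD_eq_famPow (x : Fin r → R) {k m n : ℕ} (hn : 0 < n) (hnm : n ≤ m)
    (h : boxCycles x X k m ≤ boxBoundaries x X n) (f : Finset (Fin r) → X)
    (hf : f ∈ famDeg R r X k) (hf0 : powD x X m f = 0) :
    ∃ w, powD x X n w = famPow x m n f := by
  have h1 : famIota x X m f ∈ boxCycles x X k m := by
    refine ⟨famIota_mem_famDeg x m hf, ?_⟩
    have := cechD_famIota x m f
    rwa [hf0, map_zero, sub_zero] at this
  obtain ⟨w, hw⟩ := mem_boxBoundaries.1 (h h1)
  have h2 : famIota x X n (famPow x m n f) - cechD x X w ∈ famFil R r X n := by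
    have := Submodule.sub_mem _ hw (famIota_famPow x hnm f)
    simpa using this
  -- On the box, `dw` agrees with an image of the comparison, so the primitive can be normalised
  -- although it is not a cycle.
  have h3 : ∀ i, cechD x X w ∈ famStd x X n i := fun i => by
    have := Submodule.sub_mem _ (famIota_mem_famStd x n (famPow x m n f) i)
      (famFil_le_famStd x n i h2)
    simpa using this
  obtain ⟨v, hv⟩ := exists_std x n w h3
  have h4 := sub_famIota_mem_famFil hn hv
  set c : Finset (Fin r) → X := fun S => (w - cechD x X v) S (boxCorner n S)
  refine ⟨c, sub_eq_zero.1 (eq_zero_of_famIota_mem hn (x := x) ?_)⟩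
  have h5 := cechD_mem_famFil x h4
  rw [map_sub, map_sub, cechD_cechD, sub_zero] at h5
  have := Submodule.add_mem _ (Submodule.add_mem _ h5 (cechD_famIota x n c)) h2
  rw [map_sub]
  convert Submodule.neg_mem _ this using 1
  abel

end Comparison

/-! ### Inverse systems of truncated homology -/

section Towers

variable {R : Type u} [CommRing R] {r : ℕ}

theorem exists_dependent_seq {α : Type*} (P : ℕ → α → Prop) (Q : ℕ → α → α → Prop) {a : α}
    (ha : P 0 a) (h : ∀ n a, P n a → ∃ b, P (n + 1) b ∧ Q n a b) :
    ∃ f : ℕ → α, f 0 = a ∧ ∀ n, P n (f n) ∧ Q n (f n) (f (n + 1)) := by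
  choose! g hg using h
  let f : ℕ → α := fun n => Nat.rec a (fun n b => g n b) n
  have hf : ∀ n, P n (f n) := by
    intro n
    induction n with
    | zero => exact ha
    | succ n ih => exact (hg n _ ih).1
  exact ⟨f, rfl, fun n => ⟨hf n, (hg n _ (hf n)).2⟩⟩

theorem exists_boundary_of_deg {X : Type v} [AddCommGroup X] [Module R X] {x : Fin r → R}
    {k n : ℕ} {g : PowFam r X} (hg : g ∈ famDeg R r _ k) (h : g ∈ boxBoundaries x X n) :
    ∃ w ∈ famDeg R r _ (k + 1), g - cechD x X w ∈ famFil R r X n := by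
  obtain ⟨w, hw⟩ := mem_boxBoundaries.1 h
  refine ⟨famTrunc (k + 1) w, famTrunc_mem _ _, ?_⟩
  rw [kosD_famTrunc, ← famTrunc_of_mem hg]
  have : famTrunc k g - famTrunc k (cechD x X w) = famTrunc k (g - cechD x X w) := by
    funext S
    simp only [famTrunc, Pi.sub_apply]
    split_ifs <;> simp
  rw [this]
  exact famTrunc_mem_famFil hw

/-- The homology in degree `k` of truncated power series is pro-zero. -/
def IsProZeroBox (x : Fin r → R) (X : Type v) [AddCommGroup X] [Module R X] (k : ℕ) : Prop :=
  ∀ n, ∃ m, n ≤ m ∧ boxCycles x X k m ≤ boxBoundaries x X n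

/-! ### Elementary forms of the vanishing of `lim¹` -/

section Limit

variable {X : Type v} [AddCommGroup X] [Module R X] {x : Fin r → R}

/-- Two approximate primitives of `g` differ by an approximate cycle, which is a boundary modulo a
smaller box by pro-vanishing. Correcting by these boundaries makes the primitives converge. -/
theorem mem_range_of_forall_mem_boxBoundaries {k : ℕ} (hp : IsProZeroBox x X (k + 1))
    {g : PowFam r X} (hg : g ∈ famDeg R r _ k) (h : ∀ n, g ∈ boxBoundaries x X n) :
    ∃ w, cechD x X w = g := by
  choose μ hμ hμB using hp
  -- The `+ 1` makes the levels strictly increasing.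
  let s : ℕ → ℕ := fun j => Nat.rec 0 (fun _ n => μ n + 1) j
  have hs : StrictMono s := strictMono_nat_of_lt_succ fun j => Nat.lt_succ_of_le (hμ (s j))
  have hsB : ∀ j, boxCycles x X (k + 1) (s (j + 1)) ≤ boxBoundaries x X (s j) := fun j =>
    (boxCycles_antitone x _ (Nat.le_succ _)).trans (hμB (s j))
  obtain ⟨w0, hw0, hw0'⟩ := exists_boundary_of_deg hg (h (s 1))
  obtain ⟨w, -, hw⟩ := exists_dependent_seq
    -- A primitive up to level `s (j + 1)` is controlled only at level `s j`: pro-vanishing costs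
    -- one step.
    (fun j (w : PowFam r X) => w ∈ famDeg R r _ (k + 1) ∧
      g - cechD x X w ∈ famFil R r X (s (j + 1)))
    (fun j w w' => w' - w ∈ famFil R r X (s j)) ⟨hw0, hw0'⟩ (by
      rintro j w ⟨hw, hw'⟩
      obtain ⟨y, hy, hy'⟩ := exists_boundary_of_deg hg (h (s (j + 2)))
      have hc : y - w ∈ boxCycles x X (k + 1) (s (j + 1)) := by
        refine ⟨Submodule.sub_mem _ hy hw, ?_⟩
        have := Submodule.sub_mem _ hw' (famFil_antitone (hs.monotone (Nat.le_succ (j + 1))) hy')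
        rw [sub_sub_sub_cancel_left, ← map_sub] at this
        exact this
      obtain ⟨v, hv, hv'⟩ := exists_boundary_of_deg (Submodule.sub_mem _ hy hw) (hsB j hc)
      refine ⟨y - cechD x X v, ⟨Submodule.sub_mem _ hy (kosD_mem_famDeg _ hv), ?_⟩, ?_⟩
      · rwa [map_sub, cechD_cechD, sub_zero]
      · rwa [sub_right_comm])
  obtain ⟨l, hl⟩ := exists_limit hs w fun j => (hw j).2
  refine ⟨l, (sub_eq_zero.1 (eq_zero_of_forall_mem_famFil (R := R) fun n => ?_)).symm⟩
  refine famFil_antitone (hs.id_le n) ?_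
  have h1 := famFil_antitone (hs.monotone (Nat.le_succ n)) (hw n).1.2
  have h2 := cechD_mem_famFil x (hl n)
  have := Submodule.sub_mem _ h1 h2
  rw [map_sub] at this
  convert this using 1
  abel

/-- Any sequence of cycles of truncated power series is, up to truncation, the sequence of the
successive differences of another one, if boundaries can be detected on truncations. -/
theorem exists_sub_succ_eq {k : ℕ}
    (h0 : ∀ g ∈ famDeg R r ((Fin r → ℕ) → X) k, cechD x X g = 0 →
      (∀ n, g ∈ boxBoundaries x X n) → ∃ w, cechD x X w = g)
    {s : ℕ → ℕ} (hs : StrictMono s) (b : ℕ → PowFam r X)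
    (hb : ∀ j, b j ∈ boxCycles x X (k + 1) (s j)) :
    ∃ c : ℕ → PowFam r X, (∀ j, c j ∈ boxCycles x X (k + 1) (s j)) ∧
      ∀ j, c j - c (j + 1) = b j := by
  -- The sums `σ j` need not converge, but their differentials do. If the limit is `dw`, then `w - σ
  -- j` is the required cycle at level `s j`.
  let σ : ℕ → PowFam r X := fun j => ∑ i ∈ Finset.range j, b i
  have hσ : ∀ j, σ j ∈ famDeg R r _ (k + 1) := fun j =>
    Submodule.sum_mem _ fun i _ => (hb i).1
  obtain ⟨l, hl⟩ := exists_limit (R := R) hs (fun j => cechD x X (σ j)) fun j => by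
    rw [← map_sub (cechD x X)]
    simp only [σ, Finset.sum_range_succ, add_sub_cancel_left]
    exact (hb j).2
  set z := famTrunc k l
  have hz : ∀ j, z - cechD x X (σ j) ∈ famFil R r X (s j) := by
    intro j
    have : z - cechD x X (σ j) = famTrunc k (l - cechD x X (σ j)) := by
      rw [← famTrunc_of_mem (kosD_mem_famDeg (subU x X) (hσ j))]
      funext S
      simp only [z, famTrunc, Pi.sub_apply]
      split_ifs <;> simp
    rw [this]
    exact famTrunc_mem_famFil (hl j)
  -- `z` agrees with `dσ` to any prescribed order, so it is a cycle and a boundary modulo every box.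
  obtain ⟨w, hw⟩ := h0 z (famTrunc_mem _ _)
    (eq_zero_of_forall_mem_famFil (R := R) fun n => famFil_antitone (hs.id_le n) <| by
      have := cechD_mem_famFil x (hz n)
      rwa [map_sub, cechD_cechD, sub_zero] at this)
    (fun n => mem_boxBoundaries.2 ⟨σ n, famFil_antitone (hs.id_le n) (hz n)⟩)
  have hw' : cechD x X (famTrunc (k + 1) w) = z := by
    rw [kosD_famTrunc, hw, famTrunc_of_mem (famTrunc_mem (R := R) _ _)]
  refine ⟨fun j => famTrunc (k + 1) w - σ j,
    fun j => ⟨Submodule.sub_mem _ (famTrunc_mem _ _) (hσ j), ?_⟩, fun j => ?_⟩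
  · change cechD x X (famTrunc (k + 1) w - σ j) ∈ famFil R r X (s j)
    rw [map_sub, hw']
    exact hz j
  · simp only [σ, Finset.sum_range_succ]
    abel

end Limit

/-! ### Change of coefficients -/

section Functoriality

variable {X : Type v} [AddCommGroup X] [Module R X] {Y : Type w} [AddCommGroup Y] [Module R Y]

/-- The map of families of power series induced by a linear map of coefficients. -/
def famMap (φ : X →ₗ[R] Y) : PowFam r X →ₗ[R] PowFam r Y where
  toFun g S b := φ (g S b)
  map_add' f g := by funext S b; exact map_add φ _ _
  map_smul' c g := by funext S b; exact map_smul φ _ _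

theorem famMap_apply (φ : X →ₗ[R] Y) (g : PowFam r X) (S : Finset (Fin r)) (b : Fin r → ℕ) :
    famMap φ g S b = φ (g S b) := rfl

theorem famMap_mem_famDeg (φ : X →ₗ[R] Y) {k : ℕ} {g : PowFam r X} (hg : g ∈ famDeg R r _ k) :
    famMap φ g ∈ famDeg R r _ k := by
  intro S hS
  funext b
  rw [famMap_apply, hg S hS, Pi.zero_apply, map_zero, Pi.zero_apply]

theorem famMap_mem_famFil (φ : X →ₗ[R] Y) {n : ℕ} {g : PowFam r X} (hg : g ∈ famFil R r X n) :
    famMap φ g ∈ famFil R r Y n := by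
  intro S b hb
  rw [famMap_apply, hg S b hb, map_zero]

theorem cechD_famMap (x : Fin r → R) (φ : X →ₗ[R] Y) (g : PowFam r X) :
    cechD x Y (famMap φ g) = famMap φ (cechD x X g) := by
  funext T b
  rw [famMap_apply, kosD_apply, kosD_apply, Finset.sum_apply, Finset.sum_apply, map_sum]
  refine Finset.sum_congr rfl fun i _ => ?_
  split_ifs
  · exact (map_zero φ).symm
  · rw [Pi.smul_apply, Pi.smul_apply, map_zsmul, subU_apply, subU_apply, map_sub, map_smul]
    congr 2
    split_ifs
    · rfl
    · exact (map_zero φ).symm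

theorem famMap_mem_boxCycles {x : Fin r → R} (φ : X →ₗ[R] Y) {k n : ℕ} {g : PowFam r X}
    (hg : g ∈ boxCycles x X k n) : famMap φ g ∈ boxCycles x Y k n := by
  refine ⟨famMap_mem_famDeg φ hg.1, ?_⟩
  change cechD x Y (famMap φ g) ∈ famFil R r Y n
  rw [cechD_famMap]
  exact famMap_mem_famFil φ hg.2

end Functoriality

/-! ### Countable direct sums and the Mittag-Leffler condition -/

section MittagLeffler

variable {X : Type v} [AddCommGroup X] [Module R X] {M : Type w} [AddCommGroup M] [Module R M]
  {x : Fin r → R}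

/-- If boundaries can be detected on truncations for a countable direct sum of copies of `M`,
then the homology of truncated power series over `M` is a Mittag-Leffler inverse system. -/
theorem boxCycles_mittagLeffler (e : X ≃ₗ[R] (ℕ →₀ M)) {k : ℕ}
    (h0 : ∀ g ∈ famDeg R r ((Fin r → ℕ) → X) k, cechD x X g = 0 →
      (∀ n, g ∈ boxBoundaries x X n) → ∃ w, cechD x X w = g) (N : ℕ) :
    ∃ m, N ≤ m ∧ ∀ m', m ≤ m' →
      boxCycles x M (k + 1) m ≤ boxCycles x M (k + 1) m' ⊔ boxBoundaries x M N := by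
  by_contra! hcon
  have hcon' : ∀ m, N ≤ m → ∃ m' a, m < m' ∧ a ∈ boxCycles x M (k + 1) m ∧
      a ∉ boxCycles x M (k + 1) m' ⊔ boxBoundaries x M N := by
    intro m hm
    obtain ⟨m', hm', h⟩ := hcon m hm
    obtain ⟨a, ha, ha'⟩ := SetLike.not_le_iff_exists.1 h
    refine ⟨m', a, lt_of_le_of_ne hm' ?_, ha, ha'⟩
    rintro rfl
    exact ha' (Submodule.mem_sup_left ha)
  choose! μ a hμ ha ha' using hcon'
  -- At level `s j` the chosen cycle does not lift to level `s (j + 1)`, modulo boundaries for the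
  -- box `N`.
  let s : ℕ → ℕ := fun j => Nat.rec N (fun _ n => μ n) j
  have hN : ∀ j, N ≤ s j := by
    intro j
    induction j with
    | zero => exact le_rfl
    | succ j ih => exact ih.trans (hμ _ ih).le
  have hs : StrictMono s := strictMono_nat_of_lt_succ fun j => hμ _ (hN j)
  let emb : ℕ → M →ₗ[R] X := fun j => e.symm.toLinearMap ∘ₗ Finsupp.lsingle j
  let coef : ℕ → X →ₗ[R] M := fun j => Finsupp.lapply j ∘ₗ e.toLinearMap
  -- The bad cycle of index `j` is placed in the `j`-th summand, which keeps the cycles independent.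
  obtain ⟨c, hc, hcb⟩ := exists_sub_succ_eq h0 hs (fun j => famMap (emb j) (a (s j)))
    fun j => famMap_mem_boxCycles _ (ha _ (hN j))
  have hcoef : ∀ i j (g : PowFam r M), famMap (coef i) (famMap (emb j) g) =
      if j = i then g else 0 := by
    intro i j g
    funext S b
    rw [famMap_apply, famMap_apply]
    simp only [coef, emb, LinearMap.comp_apply, LinearEquiv.coe_coe, LinearEquiv.apply_symm_apply,
      Finsupp.lsingle_apply, Finsupp.lapply_apply, Finsupp.single_apply]
    split_ifs <;> rfl
  have hsum : ∀ j, c 0 - c j = ∑ i ∈ Finset.range j, famMap (emb i) (a (s i)) := by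
    intro j
    rw [← Finset.sum_range_sub' c j]
    exact Finset.sum_congr rfl fun i _ => hcb i
  -- Finitely many coefficients of `c 0` lie in the box, each of finite support, so some coordinate
  -- `J` sees none of them.
  obtain ⟨J, hJ⟩ : ∃ J, famMap (coef J) (c 0) ∈ famFil R r M N := by
    obtain ⟨J, hJ⟩ := Infinite.exists_notMem_finset (α := ℕ)
      (Finset.univ.biUnion fun S => (expBox r N).biUnion fun b => (e (c 0 S b)).support)
    refine ⟨J, fun S b hb => ?_⟩
    rw [famMap_apply]
    by_contra hne
    refine hJ (Finset.mem_biUnion.2 ⟨S, Finset.mem_univ _, Finset.mem_biUnion.2 ⟨b, hb, ?_⟩⟩)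
    exact Finsupp.mem_support_iff.2 hne
  refine ha' _ (hN J) ?_
  -- In coordinate `J`, the bad cycle equals `c 0 - c (J + 1)`. The first term vanishes on the box
  -- `N` and the second is a cycle at level `s (J + 1)`, a contradiction.
  have h1 := congrArg (famMap (coef J)) (hsum (J + 1))
  rw [map_sub, map_sum] at h1
  simp only [hcoef] at h1
  rw [Finset.sum_ite_eq' , if_pos (Finset.mem_range.2 (Nat.lt_succ_self J))] at h1
  rw [← h1]
  exact Submodule.sub_mem _
    (Submodule.mem_sup_right (Submodule.mem_sup_right hJ))
    (Submodule.mem_sup_left (famMap_mem_boxCycles _ (hc (J + 1))))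

/-- A criterion for pro-vanishing in terms of the homology of families of power series over a
countable direct sum. -/
theorem isProZeroBox_of_exact (e : X ≃ₗ[R] (ℕ →₀ M)) {k : ℕ}
    (h0 : ∀ g ∈ famDeg R r ((Fin r → ℕ) → X) k, cechD x X g = 0 →
      (∀ n, g ∈ boxBoundaries x X n) → ∃ w, cechD x X w = g)
    (h1 : ∀ g ∈ famDeg R r ((Fin r → ℕ) → X) (k + 1), cechD x X g = 0 → ∃ w, cechD x X w = g) :
    IsProZeroBox x M (k + 1) := by
  choose ν hν hνML using boxCycles_mittagLeffler e h0
  intro N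
  refine ⟨ν N, hν N, fun a ha => ?_⟩
  -- By Mittag-Leffler, `a` extends to cycles of growing level, each agreeing with the previous one
  -- on a growing box; they converge to an honest cycle.
  obtain ⟨y, rfl, hy⟩ := exists_dependent_seq
    (fun j y => y ∈ boxCycles x M (k + 1) (ν (N + j)))
    (fun j y y' => y' - y ∈ famFil R r M (N + j)) (a := a) ha (by
      intro j y hy
      obtain ⟨z, hz, β, hβ, rfl⟩ := Submodule.mem_sup.1
        (hνML (N + j) _ (le_max_left _ (ν (N + (j + 1)))) hy)
      have hβd : β ∈ famDeg R r _ (k + 1) := by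
        rw [← add_sub_cancel_left z β]
        exact Submodule.sub_mem _ hy.1 hz.1
      obtain ⟨v, hv, hv'⟩ := exists_boundary_of_deg hβd hβ
      refine ⟨z + cechD x M v, boxCycles_antitone x _ (le_max_right _ _)
        (Submodule.add_mem _ hz ⟨kosD_mem_famDeg _ hv, ?_⟩), ?_⟩
      · change cechD x M (cechD x M v) ∈ famFil R r M _
        rw [cechD_cechD]
        exact Submodule.zero_mem _
      · rw [add_sub_add_left_eq_sub, ← neg_sub]
        exact Submodule.neg_mem _ hv')
  have hs : StrictMono fun j => N + j := fun i j h => Nat.add_lt_add_left h N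
  obtain ⟨l, hl⟩ := exists_limit hs y fun j => (hy j).2
  have hz : ∀ j, famTrunc (k + 1) l - y j ∈ famFil R r M (N + j) := by
    intro j
    have : famTrunc (k + 1) l - y j = famTrunc (k + 1) (l - y j) := by
      nth_rewrite 1 [← famTrunc_of_mem (hy j).1.1]
      funext S
      simp only [famTrunc, Pi.sub_apply]
      split_ifs <;> simp
    rw [this]
    exact famTrunc_mem_famFil (hl j)
  have hD : cechD x M (famTrunc (k + 1) l) = 0 := eq_zero_of_forall_mem_famFil (R := R) fun n => by
    have h2 := Submodule.add_mem _ (cechD_mem_famFil x (hz n))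
      (famFil_antitone (hν (N + n)) (hy n).1.2)
    rw [map_sub, sub_add_cancel] at h2
    exact famFil_antitone (Nat.le_add_left n N) h2
  -- `M` is a direct summand of `X`, so exactness over `X` gives a primitive over `M`.
  obtain ⟨w, hw⟩ := h1 (famMap (e.symm.toLinearMap ∘ₗ Finsupp.lsingle 0) (famTrunc (k + 1) l))
    (famMap_mem_famDeg _ (famTrunc_mem _ _)) (by rw [cechD_famMap, hD, map_zero])
  have hw' : cechD x M (famMap (Finsupp.lapply 0 ∘ₗ e.toLinearMap) w) = famTrunc (k + 1) l := by
    rw [cechD_famMap, hw]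
    funext S b
    simp [famMap_apply]
  rw [mem_boxBoundaries]
  refine ⟨famMap (Finsupp.lapply 0 ∘ₗ e.toLinearMap) w, ?_⟩
  rw [hw', ← neg_sub]
  exact Submodule.neg_mem _ (hz 0)

end MittagLeffler

end Towers

/-! ### Evaluation at `U = x` and the completion -/

section Evaluation

variable {R : Type u} [CommRing R] {r : ℕ} {X : Type v} [AddCommGroup X] [Module R X]

theorem update_pred_eq_sub {b : Fin r → ℕ} (i : Fin r) :
    Function.update b i (b i - 1) = b - Pi.single i 1 := by
  funext j
  by_cases hj : j = i
  · subst hj; simp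
  · simp [hj]

theorem map_mulSub_single (x : Fin r → R) (i : Fin r) (ψ : InvPoly R r →ₗ[R] X)
    (b : Fin r → ℕ) :
    ψ (InvPoly.mulSub x i (Finsupp.single b 1)) =
      subU x X i (fun c => ψ (Finsupp.single c 1)) b := by
  rw [InvPoly.mulSub_single, subU_apply, map_sub, map_smul, update_pred_eq_sub]
  congr 1
  split_ifs
  · rfl
  · exact map_zero ψ

/-- The partial sums of the evaluation at `U = x` over the box of size `n`. -/
noncomputable def evalBox (x : Fin r → R) (X : Type v) [AddCommGroup X] [Module R X] (n : ℕ) :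
    ((Fin r → ℕ) → X) →ₗ[R] X :=
  ∑ b ∈ expBox r n, (∏ i, x i ^ b i) • LinearMap.proj b

theorem evalBox_apply (x : Fin r → R) (n : ℕ) (g : (Fin r → ℕ) → X) :
    evalBox x X n g = ∑ b ∈ expBox r n, (∏ i, x i ^ b i) • g b := by
  simp [evalBox]

theorem evalBox_eq_zero (x : Fin r → R) {n : ℕ} {g : PowFam r X} (hg : g ∈ famFil R r X n)
    (S : Finset (Fin r)) : evalBox x X n (g S) = 0 := by
  rw [evalBox_apply]
  exact Finset.sum_eq_zero fun b hb => by rw [hg S b hb, smul_zero]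

theorem evalBox_subU_mem (x : Fin r → R) (n : ℕ) (i : Fin r) (g : (Fin r → ℕ) → X) :
    evalBox x X n (subU x X i g) ∈ (seqIdeal x ^ n • ⊤ : Submodule R X) := by
  -- A power series is a linear form on inverse polynomials, for which the telescoping is known.
  have h := boundary_sum_mem x X n i (Finsupp.linearCombination R g)
  rw [evalBox_apply]
  convert h using 3 with b
  rw [map_mulSub_single]
  simp

theorem evalBox_cechD_mem (x : Fin r → R) (n : ℕ) (w : PowFam r X) :
    evalBox x X n (cechD x X w ∅) ∈ (seqIdeal x ^ n • ⊤ : Submodule R X) := by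
  rw [kosD_apply, map_sum]
  refine Submodule.sum_mem _ fun i _ => ?_
  rw [if_neg (Finset.notMem_empty i), map_zsmul]
  exact zsmul_mem (evalBox_subU_mem x n i _) _

theorem evalBox_mem_of_mem_boxBoundaries {x : Fin r → R} {n : ℕ} {g : PowFam r X}
    (hg : g ∈ boxBoundaries x X n) :
    evalBox x X n (g ∅) ∈ (seqIdeal x ^ n • ⊤ : Submodule R X) := by
  obtain ⟨w, hw⟩ := mem_boxBoundaries.1 hg
  have := evalBox_eq_zero x hw ∅
  rw [Pi.sub_apply, map_sub, sub_eq_zero] at this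
  rw [this]
  exact evalBox_cechD_mem x n w

theorem seqIdeal_pow_smul_top_le (x : Fin r → R) (X : Type v) [AddCommGroup X] [Module R X]
    (n : ℕ) : (seqIdeal x ^ n • ⊤ : Submodule R X) ≤
      Submodule.span R {y | ∃ (b : Fin r → ℕ) (m : X), ∑ i, b i = n ∧
        y = (∏ i, x i ^ b i) • m} := by
  induction n with
  | zero =>
    intro y _
    exact Submodule.subset_span ⟨0, y, by simp, by simp⟩
  | succ n ih =>
    rw [pow_succ', Submodule.mul_smul]
    refine (Submodule.smul_mono le_rfl ih).trans (Submodule.smul_le.2 fun a ha y hy => ?_)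
    induction hy using Submodule.span_induction with
    | zero => rw [smul_zero]; exact Submodule.zero_mem _
    | add y z _ _ hy hz => rw [smul_add]; exact Submodule.add_mem _ hy hz
    | smul c y _ hy => rw [smul_comm]; exact Submodule.smul_mem _ _ hy
    | mem y hy =>
      obtain ⟨b, m, hb, rfl⟩ := hy
      induction ha using Submodule.span_induction with
      | zero => rw [zero_smul]; exact Submodule.zero_mem _
      | add y z _ _ hy hz => rw [add_smul]; exact Submodule.add_mem _ hy hz
      | smul c y _ hy => rw [smul_assoc]; exact Submodule.smul_mem _ _ hy
      | mem a ha =>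
        obtain ⟨i, rfl⟩ := ha
        refine Submodule.subset_span ⟨b + Pi.single i 1, m, ?_, ?_⟩
        · simp [Finset.sum_add_distrib, hb]
        · rw [smul_smul]
          congr 1
          simp only [Pi.add_apply, pow_add, Finset.prod_mul_distrib]
          rw [mul_comm]
          congr 1
          rw [Finset.prod_eq_single i] <;> simp +contextual

theorem exists_sum_of_mem_seqIdeal_pow_smul (x : Fin r → R) {n : ℕ} {y : X}
    (hy : y ∈ (seqIdeal x ^ n • ⊤ : Submodule R X)) :
    ∃ z : (Fin r → ℕ) → X,
      ∑ b ∈ Finset.piAntidiag Finset.univ n, (∏ i, x i ^ b i) • z b = y := by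
  have h := seqIdeal_pow_smul_top_le x X n hy
  clear hy
  induction h using Submodule.span_induction with
  | zero => exact ⟨0, by simp⟩
  | add y y' _ _ hy hy' =>
    obtain ⟨z, rfl⟩ := hy
    obtain ⟨z', rfl⟩ := hy'
    exact ⟨z + z', by simp [Finset.sum_add_distrib]⟩
  | smul c y _ hy =>
    obtain ⟨z, rfl⟩ := hy
    exact ⟨c • z, by simp [Finset.smul_sum, smul_comm c]⟩
  | mem y hy =>
    obtain ⟨b, m, hb, rfl⟩ := hy
    refine ⟨Pi.single b m, ?_⟩
    rw [Finset.sum_eq_single b]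
    · simp
    · intro c _ hc
      rw [Pi.single_eq_of_ne hc, smul_zero]
    · simp [hb]

/-- Pigeonhole: a monomial of degree `r * n + 1` has an exponent at least `n`. Hence the modules `X
/ x^(n) X` compute the adic completion. -/
theorem seqIdeal_pow_smul_top_le_pow (x : Fin r → R) (X : Type v) [AddCommGroup X] [Module R X]
    (n : ℕ) : (seqIdeal x ^ (r * n + 1) • ⊤ : Submodule R X) ≤
      Submodule.span R {y | ∃ (i : Fin r) (m : X), y = x i ^ n • m} := by
  refine (seqIdeal_pow_smul_top_le x X _).trans (Submodule.span_le.2 ?_)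
  rintro _ ⟨b, m, hb, rfl⟩
  obtain ⟨i, hi⟩ : ∃ i, n ≤ b i := by
    by_contra! h
    have := Finset.sum_le_sum fun i (_ : i ∈ Finset.univ) => (h i).le
    rw [hb] at this
    simp at this
  refine Submodule.subset_span ⟨i, (x i ^ (b i - n) * ∏ j ∈ Finset.univ.erase i, x j ^ b j) • m, ?_⟩
  rw [smul_smul, ← mul_assoc, ← pow_add, Nat.add_sub_cancel' hi,
    Finset.mul_prod_erase _ (fun j => x j ^ b j) (Finset.mem_univ i)]

theorem stdCoeff_empty (x : Fin r → R) (n : ℕ) (b : Fin r → ℕ) :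
    stdCoeff x n ∅ b = if b = 0 then 1 else 0 := by
  unfold stdCoeff
  split_ifs with h
  · subst h; simp
  · obtain ⟨i, hi⟩ := Function.ne_iff.1 h
    refine Finset.prod_eq_zero (Finset.mem_univ i) ?_
    rw [if_neg (Finset.notMem_empty i), if_neg (show b i ≠ 0 from hi)]

theorem evalBox_famIota (x : Fin r → R) {n : ℕ} (hn : 0 < n) (f : Finset (Fin r) → X) :
    evalBox x X n (famIota x X n f ∅) = f ∅ := by
  rw [evalBox_apply, Finset.sum_eq_single 0]
  · simp [famIota_apply, stdCoeff_empty]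
  · intro b _ hb
    rw [famIota_apply, stdCoeff_empty, if_neg hb, zero_smul, smul_zero]
  · intro h
    exact absurd (mem_expBox.2 fun _ => hn) h

theorem powD_single_singleton (x : Fin r → R) (n : ℕ) (i : Fin r) (m : X) :
    powD x X n (Pi.single {i} m) = Pi.single ∅ (x i ^ n • m) := by
  funext T
  rw [kosD_apply]
  by_cases hT : T = ∅
  · subst hT
    rw [Finset.sum_eq_single i]
    · simp [koszulSign]
    · intro j _ hj
      simp [hj]
    · simp
  · rw [Pi.single_eq_of_ne hT]
    refine Finset.sum_eq_zero fun j _ => ?_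
    split_ifs with hj
    · rfl
    · rw [Pi.single_eq_of_ne, map_zero, smul_zero]
      intro h
      have := congrArg Finset.card h
      rw [Finset.card_insert_of_notMem hj, Finset.card_singleton] at this
      exact hT (Finset.card_eq_zero.1 (by omega))

/-- A power series whose evaluation vanishes in the completion is a boundary modulo every
truncation. -/
theorem mem_boxBoundaries_of_evalBox_mem {x : Fin r → R} {g : PowFam r X}
    (hg : g ∈ famDeg R r _ 0)
    (h : ∀ n, evalBox x X n (g ∅) ∈ (seqIdeal x ^ n • ⊤ : Submodule R X)) (n : ℕ) :
    g ∈ boxBoundaries x X n := by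
  suffices hpos : ∀ n, 0 < n → g ∈ boxBoundaries x X n from
    boxBoundaries_antitone x (Nat.le_succ n) (hpos _ n.succ_pos)
  intro n hn
  -- The level must be at least `n` for the transition and at least `r * n + 1` for the pigeonhole;
  -- for `r = 0` the second alone would not suffice.
  have hle : n ≤ max n (r * n + 1) := le_max_left _ _
  have hN := hn.trans_le hle
  obtain ⟨f, hf, -, v, hv⟩ := exists_famIota x hN (k := 0) (g := g)
    ⟨hg, by
      change cechD x X g ∈ famFil R r X _
      rw [kosD_eq_zero_of_mem_famDeg_zero _ hg]
      exact Submodule.zero_mem _⟩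
  -- In degree 0 the comparison gives constants on the box, so `f ∅` is the evaluation of `g` minus
  -- that of a boundary.
  have hf0 : f ∅ ∈ (seqIdeal x ^ max n (r * n + 1) • ⊤ : Submodule R X) := by
    have h1 := evalBox_eq_zero x hv ∅
    rw [Pi.sub_apply, Pi.sub_apply, map_sub, map_sub, evalBox_famIota x hN, sub_eq_zero] at h1
    rw [← h1]
    exact Submodule.sub_mem _ (h _) (evalBox_cechD_mem x _ v)
  have hf1 := seqIdeal_pow_smul_top_le_pow x X n
    (Submodule.smul_mono_left (Ideal.pow_le_pow_right (le_max_right _ _)) hf0)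
  have hf2 : famIota x X n (Pi.single ∅ (f ∅)) ∈ boxBoundaries x X n := by
    have : Submodule.span R {y | ∃ (i : Fin r) (m : X), y = x i ^ n • m} ≤
        (boxBoundaries x X n).comap
          (famIota x X n ∘ₗ LinearMap.single R (fun _ : Finset (Fin r) => X) ∅) := by
      refine Submodule.span_le.2 ?_
      rintro _ ⟨i, m, rfl⟩
      change famIota x X n (Pi.single ∅ (x i ^ n • m)) ∈ boxBoundaries x X n
      rw [← powD_single_singleton, mem_boxBoundaries]
      refine ⟨famIota x X n (Pi.single {i} m), ?_⟩
      rw [← neg_sub]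
      exact Submodule.neg_mem _ (cechD_famIota x n _)
    exact this hf1
  have hf3 : famPow x (max n (r * n + 1)) n f = Pi.single ∅ (f ∅) := by
    funext S
    by_cases hS : S = ∅
    · subst hS; simp [famPow]
    · rw [Pi.single_eq_of_ne hS, famPow, hf S (by rwa [Ne, Finset.card_eq_zero]), smul_zero]
  have h4 := famIota_famPow x hle f
  rw [hf3] at h4
  have h5 : g = cechD x X v + ((g - cechD x X v - famIota x X (max n (r * n + 1)) f) +
      (famIota x X (max n (r * n + 1)) f - famIota x X n (Pi.single ∅ (f ∅)))) +
      famIota x X n (Pi.single ∅ (f ∅)) := by abel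
  rw [h5]
  refine Submodule.add_mem _ (Submodule.add_mem _ ?_ ?_) hf2
  · exact Submodule.mem_sup_left ⟨v, rfl⟩
  · exact Submodule.mem_sup_right (Submodule.add_mem _ (famFil_antitone hle hv) h4)

/-- Every element of the completion is the value at `U = x` of a power series. -/
theorem exists_evalBox_eq (x : Fin r → R) (y : Completion x X) :
    ∃ g : (Fin r → ℕ) → X, ∀ n,
      (seqIdeal x ^ n • ⊤ : Submodule R X).mkQ (evalBox x X n g) = y.val n := by
  choose q hq using fun n => Submodule.mkQ_surjective _ (y.val n)
  -- Starting from `q 1` makes the first `n` terms sum to `q n` for `n > 0`; `q 0` carries no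
  -- information.
  let d : ℕ → X := fun n => if n = 0 then q 1 else q (n + 1) - q n
  have hd : ∀ n, d n ∈ (seqIdeal x ^ n • ⊤ : Submodule R X) := by
    intro n
    by_cases hn : n = 0
    · subst hn; simp
    · simp only [d, if_neg hn]
      rw [← Submodule.Quotient.mk_eq_zero, ← Submodule.mkQ_apply, map_sub, hq n, sub_eq_zero]
      have := AdicCompletion.transitionMap_comp_eval_apply (seqIdeal x) X (Nat.le_succ n) y
      change AdicCompletion.transitionMap (seqIdeal x) X (Nat.le_succ n) (y.val (n + 1)) =
        y.val n at this
      rw [← this, ← hq (n + 1)]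
      rfl
  have hsum : ∀ n, 0 < n → ∑ j ∈ Finset.range n, d j = q n := by
    intro n hn
    induction n, hn using Nat.le_induction with
    | base => simp [d]
    | succ n hn ih =>
      rw [Finset.sum_range_succ, ih]
      simp only [d, if_neg (Nat.pos_iff_ne_zero.1 hn)]
      abel
  choose z hz using fun n => exists_sum_of_mem_seqIdeal_pow_smul x (hd n)
  -- The homogeneous part of degree `j` evaluates to `d j`. The box of size `n` contains all degrees
  -- below `n`, and its remaining terms lie in `(xR)^n X`.
  refine ⟨fun b => z (∑ i, b i) b, fun n => ?_⟩
  rcases Nat.eq_zero_or_pos n with rfl | hn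
  · have : Subsingleton (X ⧸ (seqIdeal x ^ 0 • ⊤ : Submodule R X)) :=
      Submodule.Quotient.subsingleton_iff.2 (by simp)
    exact Subsingleton.elim _ _
  rw [← hq n, ← sub_eq_zero, ← map_sub, Submodule.mkQ_apply, Submodule.Quotient.mk_eq_zero,
    ← hsum n hn, evalBox_apply, ← Finset.sum_filter_add_sum_filter_not _ fun b : Fin r → ℕ => ∑ i, b i < n]
  have h1 : ∑ b ∈ expBox r n with ∑ i, b i < n, (∏ i, x i ^ b i) • z (∑ i, b i) b =
      ∑ j ∈ Finset.range n, d j := by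
    rw [← Finset.sum_fiberwise_of_maps_to (t := Finset.range n) (g := fun b : Fin r → ℕ => ∑ i, b i)
      (fun b hb => Finset.mem_range.2 (Finset.mem_filter.1 hb).2)]
    refine Finset.sum_congr rfl fun j hj => ?_
    rw [← hz j]
    refine Finset.sum_congr ?_ fun b hb => ?_
    · ext b
      rw [Finset.mem_range] at hj
      simp only [Finset.mem_filter, mem_expBox, Finset.mem_piAntidiag, Finset.mem_univ,
        implies_true, and_true]
      refine ⟨fun h => h.2, fun h => ?_⟩
      replace h : ∑ i, b i = j := h
      exact ⟨⟨fun i => lt_of_le_of_lt (Finset.single_le_sum (f := fun i => b i)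
        (fun _ _ => Nat.zero_le _) (Finset.mem_univ i)) (h ▸ hj), h ▸ hj⟩, h⟩
    · rw [Finset.mem_piAntidiag] at hb
      rw [hb.1]
  rw [h1, add_sub_cancel_left]
  refine Submodule.sum_mem _ fun b hb => ?_
  rw [Finset.mem_filter, not_lt] at hb
  refine Submodule.smul_mem_smul (Ideal.pow_le_pow_right hb.2 ?_) trivial
  rw [← Finset.prod_pow_eq_pow_sum]
  exact Ideal.prod_mem_prod fun i _ =>
    Ideal.pow_mem_pow (Ideal.subset_span (Set.mem_range_self i)) _

end Evaluation

/-! ### Linear forms on `L_x` as families of power series -/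

section Dictionary

variable {R : Type u} [CommRing R] {r : ℕ} {X : Type v} [AddCommGroup X] [Module R X]

/-- The family of power series of a linear map out of the resolution of the Čech complex. -/
noncomputable def toFam (k : ℕ) (φ : (KoszulIndex r k → InvPoly R r) →ₗ[R] X) : PowFam r X :=
  fun S b => if h : S.card = k then φ (Pi.single ⟨S, h⟩ (Finsupp.single b 1)) else 0

/-- The linear map out of the resolution of the Čech complex given by a family of power series. -/
noncomputable def ofFam (R : Type u) [CommRing R] {r : ℕ} {X : Type v} [AddCommGroup X]
    [Module R X] (k : ℕ) (g : PowFam r X) : (KoszulIndex r k → InvPoly R r) →ₗ[R] X :=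
  ∑ S : KoszulIndex r k, Finsupp.linearCombination R (g S.1) ∘ₗ LinearMap.proj S

theorem toFam_apply {k : ℕ} (φ : (KoszulIndex r k → InvPoly R r) →ₗ[R] X) {S : Finset (Fin r)}
    (h : S.card = k) (b : Fin r → ℕ) :
    toFam k φ S b = φ (Pi.single ⟨S, h⟩ (Finsupp.single b 1)) := dif_pos h

theorem toFam_mem_famDeg {k : ℕ} (φ : (KoszulIndex r k → InvPoly R r) →ₗ[R] X) :
    toFam k φ ∈ famDeg R r _ k := by
  intro S hS
  funext b
  exact dif_neg hS

theorem toFam_ofFam (k : ℕ) (g : PowFam r X) : toFam k (ofFam R k g) = famTrunc k g := by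
  funext S b
  by_cases h : S.card = k
  · rw [toFam_apply _ h, famTrunc, if_pos h, ofFam, LinearMap.sum_apply,
      Finset.sum_eq_single ⟨S, h⟩]
    · simp
    · intro T _ hT
      simp [Pi.single_eq_of_ne hT]
    · simp
  · rw [toFam_mem_famDeg _ S h, famTrunc_mem (R := R) k g S h]

theorem toFam_injective (k : ℕ) :
    Function.Injective (toFam (R := R) (r := r) (X := X) k) := by
  intro φ ψ h
  refine LinearMap.pi_ext' fun S => Finsupp.lhom_ext' fun b => LinearMap.ext_ring ?_
  have := congrFun (congrFun h S.1) b
  rwa [toFam_apply _ S.2, toFam_apply _ S.2] at this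

theorem cechResolutionD_single (x : Fin r → R) {k : ℕ} {S : Finset (Fin r)} (hS : S.card = k)
    (m : InvPoly R r) :
    cechResolutionD x k (Pi.single ⟨S, hS⟩ m) = ∑ i, if h : i ∈ S then 0 else
      koszulSign i S • (Pi.single ⟨insert i S, by rw [Finset.card_insert_of_notMem h, hS]⟩
        (InvPoly.mulSub x i m) : KoszulIndex r (k + 1) → InvPoly R r) := by
  funext T
  rw [cechResolutionD_apply, Finset.sum_apply]
  refine Finset.sum_congr rfl fun i _ => ?_
  by_cases hiS : i ∈ S
  · rw [dif_pos hiS]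
    split_ifs with hiT
    · rw [Pi.single_eq_of_ne, map_zero, smul_zero]; · rfl
      intro h
      have h' : T.1.erase i = S := congrArg Subtype.val h
      rw [← h'] at hiS
      exact Finset.notMem_erase i _ hiS
    · rfl
  · rw [dif_neg hiS, Pi.smul_apply]
    by_cases hT : T.1 = insert i S
    · obtain rfl : T = ⟨insert i S, by rw [Finset.card_insert_of_notMem hiS, hS]⟩ :=
        Subtype.ext hT
      rw [dif_pos (Finset.mem_insert_self i S), Pi.single_eq_same]
      simp only [Finset.erase_insert hiS, Pi.single_eq_same]
    · rw [Pi.single_eq_of_ne (fun h => hT (congrArg Subtype.val h)), smul_zero]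
      split_ifs with hiT
      · rw [Pi.single_eq_of_ne, map_zero, smul_zero]
        intro h
        have h' : T.1.erase i = S := congrArg Subtype.val h
        exact hT (by rw [← h', Finset.insert_erase hiT])
      · rfl

/-- Multiplication by `x_i - U_i` on power series is the transpose of that on inverse polynomials.
-/
theorem toFam_comp (x : Fin r → R) (k : ℕ)
    (φ : (KoszulIndex r (k + 1) → InvPoly R r) →ₗ[R] X) :
    toFam k (φ ∘ₗ cechResolutionD x k) = cechD x X (toFam (k + 1) φ) := by
  funext S b
  by_cases hS : S.card = k
  · rw [toFam_apply _ hS, LinearMap.comp_apply, cechResolutionD_single, map_sum, kosD_apply,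
      Finset.sum_apply]
    refine Finset.sum_congr rfl fun i _ => ?_
    by_cases hi : i ∈ S
    · rw [dif_pos hi, if_pos hi, map_zero]; rfl
    · have hc : (insert i S).card = k + 1 := by rw [Finset.card_insert_of_notMem hi, hS]
      rw [dif_neg hi, if_neg hi, map_zsmul, Pi.smul_apply]
      congr 1
      have := map_mulSub_single x i (φ ∘ₗ LinearMap.single R
        (fun _ : KoszulIndex r (k + 1) => InvPoly R r) ⟨insert i S, hc⟩) b
      rw [LinearMap.comp_apply] at this
      refine this.trans (congrFun (congrArg _ ?_) b)
      funext c
      rw [toFam_apply _ hc]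
      rfl
  · rw [toFam_mem_famDeg _ S hS, kosD_mem_famDeg _ (toFam_mem_famDeg φ) S hS]

theorem cechEval_val (x : Fin r → R) (φ : (KoszulIndex r 0 → InvPoly R r) →ₗ[R] X) (n : ℕ) :
    (cechEval x X φ).val n =
      (seqIdeal x ^ n • ⊤ : Submodule R X).mkQ (evalBox x X n (toFam 0 φ ∅)) := by
  change cechEvalMod x X n φ = _
  rw [cechEvalMod_apply, evalBox_apply]
  congr 1
  refine Finset.sum_congr rfl fun b _ => ?_
  rw [toFam_apply φ Finset.card_empty]
  congr 2
  funext T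
  obtain rfl : T = ⟨∅, Finset.card_empty⟩ := Subtype.ext (Finset.card_eq_zero.1 T.2)
  rw [Pi.single_eq_same]
  rfl

/-- Extension by zero of an element of the Koszul complex to all subsets. -/
def koszulExt (k : ℕ) (f : KoszulIndex r k → X) : Finset (Fin r) → X :=
  fun S => if h : S.card = k then f ⟨S, h⟩ else 0

theorem koszulExt_apply {k : ℕ} (f : KoszulIndex r k → X) {S : Finset (Fin r)}
    (h : S.card = k) : koszulExt k f S = f ⟨S, h⟩ := dif_pos h

theorem koszulExt_mem_famDeg {k : ℕ} (f : KoszulIndex r k → X) :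
    koszulExt k f ∈ famDeg R r _ k := fun _ hS => dif_neg hS

theorem koszulExt_restrict (k : ℕ) (f : Finset (Fin r) → X) :
    koszulExt k (fun S => f S.1) = famTrunc k f := by
  funext S
  unfold koszulExt famTrunc
  split_ifs <;> rfl

theorem koszulExt_injective (k : ℕ) : Function.Injective (koszulExt (r := r) (X := X) k) := by
  intro f g h
  funext S
  have := congrFun h S.1
  rwa [koszulExt_apply _ S.2, koszulExt_apply _ S.2] at this

theorem koszulExt_zero (k : ℕ) : koszulExt (r := r) (X := X) k 0 = 0 := by
  funext S
  unfold koszulExt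
  split_ifs <;> rfl

theorem powD_koszulExt (x : Fin r → R) (n k : ℕ) (f : KoszulIndex r (k + 1) → X) :
    powD x X n (koszulExt (k + 1) f) = koszulExt k (koszulD (fun i => x i ^ n) X k f) := by
  funext T
  by_cases hT : T.card = k
  · rw [kosD_apply, koszulExt_apply _ hT, koszulD_apply]
    refine Finset.sum_congr rfl fun i _ => ?_
    by_cases hi : i ∈ T
    · rw [if_pos hi, dif_pos hi]
    · rw [if_neg hi, dif_neg hi,
        koszulExt_apply f (by rw [Finset.card_insert_of_notMem hi, hT])]
      rfl
  · rw [kosD_mem_famDeg _ (koszulExt_mem_famDeg (R := R) f) T hT,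
      koszulExt_mem_famDeg (R := R) _ T hT]

theorem famPow_koszulExt (x : Fin r → R) (m n k : ℕ) (f : KoszulIndex r k → X) :
    famPow x m n (koszulExt k f) = koszulExt k (koszulPowMap x X m n k f) := by
  funext T
  unfold famPow koszulExt
  split_ifs
  · rfl
  · exact smul_zero _

end Dictionary

/-! ### Homology of complexes of modules in terms of elements -/

section ChainComplexHomology

variable {R : Type u} [Ring R]

/-- In degree 0 the homology is the whole cokernel of `d`, so only the kernel and image of `f`
matter. -/
theorem bijective_homologyι_comp_descOpcycles_iff (K : ChainComplex (ModuleCat.{v} R) ℕ)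
    {A : ModuleCat.{v} R} (f : K.X 0 ⟶ A) (hf : K.d 1 0 ≫ f = 0) :
    Function.Bijective (K.homologyι 0 ≫ K.descOpcycles f 1 (by simp) hf) ↔
      Function.Surjective f ∧ ∀ a, f a = 0 → ∃ b, K.d 1 0 b = a := by
  set δ := K.descOpcycles f 1 (by simp) hf
  have hp : Function.Surjective (K.pOpcycles 0) :=
    (ModuleCat.epi_iff_surjective _).1 inferInstance
  have hι : Function.Bijective (K.homologyι 0) :=
    (ConcreteCategory.isIso_iff_bijective (K.homologyι 0)).1
      (K.isIso_homologyι 0 _ rfl (by simp))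
  have hδ : ∀ a, δ (K.pOpcycles 0 a) = f a := by
    intro a
    rw [← ModuleCat.comp_apply, K.p_descOpcycles]
  have hker : ∀ a, K.pOpcycles 0 a = 0 ↔ ∃ b, K.d 1 0 b = a := by
    intro a
    constructor
    · exact (ShortComplex.moduleCat_exact_iff _).1 (ShortComplex.exact_of_g_is_cokernel
        (ShortComplex.mk _ _ (K.d_pOpcycles 1 0)) (K.opcyclesIsCokernel 1 0 (by simp))) a
    · rintro ⟨b, rfl⟩
      rw [← ModuleCat.comp_apply, K.d_pOpcycles]
      rfl
  have hcomp : ⇑(ConcreteCategory.hom (K.homologyι 0 ≫ δ)) = δ ∘ K.homologyι 0 := by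
    funext z
    rfl
  rw [hcomp, Function.Bijective.of_comp_iff _ hι]
  constructor
  · rintro ⟨hinj, hsurj⟩
    refine ⟨fun y => ?_, fun a ha => (hker a).1 (hinj ?_)⟩
    · obtain ⟨z, rfl⟩ := hsurj y
      obtain ⟨a, rfl⟩ := hp z
      exact ⟨a, (hδ a).symm⟩
    · rw [hδ, ha, map_zero]
  · rintro ⟨hsurj, hinj⟩
    refine ⟨(injective_iff_map_eq_zero _).2 fun z hz => ?_, fun y => ?_⟩
    · obtain ⟨a, rfl⟩ := hp z
      rw [hδ] at hz
      exact (hker a).2 (hinj a hz)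
    · obtain ⟨a, rfl⟩ := hsurj y
      exact ⟨_, hδ a⟩

theorem homologyMap_eq_zero_iff {K L : ChainComplex (ModuleCat.{v} R) ℕ} (φ : K ⟶ L) (k : ℕ) :
    HomologicalComplex.homologyMap φ (k + 1) = 0 ↔
      ∀ a, K.d (k + 1) k a = 0 → ∃ b, L.d (k + 2) (k + 1) b = φ.f (k + 1) a := by
  have hi : Function.Injective (L.iCycles (k + 1)) :=
    (ModuleCat.mono_iff_injective _).1 inferInstance
  have hπ : ∀ z, L.homologyπ (k + 1) z = 0 ↔
      ∃ b, L.d (k + 2) (k + 1) b = L.iCycles (k + 1) z := by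
    intro z
    constructor
    · intro h
      obtain ⟨b, hb⟩ := (ShortComplex.moduleCat_exact_iff _).1
        (ShortComplex.exact_of_g_is_cokernel
          (ShortComplex.mk _ _ (L.toCycles_comp_homologyπ (k + 2) (k + 1)))
          (L.homologyIsCokernel (k + 2) (k + 1) (by simp))) z h
      refine ⟨b, ?_⟩
      rw [← hb, ← L.toCycles_i (k + 2) (k + 1)]
      rfl
    · rintro ⟨b, hb⟩
      rw [← L.toCycles_i (k + 2) (k + 1), ModuleCat.comp_apply] at hb
      rw [← hi hb, ← ModuleCat.comp_apply, L.toCycles_comp_homologyπ]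
      rfl
  rw [← cancel_epi (K.homologyπ (k + 1)), HomologicalComplex.homologyπ_naturality,
    Limits.comp_zero]
  constructor
  · intro h a ha
    obtain ⟨z, rfl⟩ := (ShortComplex.moduleCat_exact_iff _).1
      (ShortComplex.exact_of_f_is_kernel (ShortComplex.mk _ _ (K.iCycles_d (k + 1) k))
        (K.cyclesIsKernel (k + 1) k (by simp))) a ha
    obtain ⟨b, hb⟩ := (hπ (HomologicalComplex.cyclesMap φ (k + 1) z)).1 (by
      rw [← ModuleCat.comp_apply, h]; rfl)
    refine ⟨b, hb.trans ?_⟩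
    rw [← ModuleCat.comp_apply, HomologicalComplex.cyclesMap_i]
    rfl
  · intro h
    refine ModuleCat.hom_ext (LinearMap.ext fun z => ?_)
    change L.homologyπ (k + 1) (HomologicalComplex.cyclesMap φ (k + 1) z) = 0
    rw [hπ]
    obtain ⟨b, hb⟩ := h (K.iCycles (k + 1) z) (by
      rw [← ModuleCat.comp_apply, K.iCycles_d]; rfl)
    refine ⟨b, hb.trans ?_⟩
    rw [← ModuleCat.comp_apply, ← ModuleCat.comp_apply, HomologicalComplex.cyclesMap_i]

end ChainComplexHomology

/-! ### Translation of both conditions and the implications -/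

section Homology

variable {R : Type u} [CommRing R] {r : ℕ} (x : Fin r → R) (X : Type v) [AddCommGroup X]
  [Module R X]

theorem cechHomComplex_d (k : ℕ) :
    (cechHomComplex x X).d (k + 1) k =
      ModuleCat.ofHom (LinearMap.lcomp R X (cechResolutionD x k)) :=
  congrArg (fun f => ModuleCat.ofHom (LinearMap.lcomp R X (ModuleCat.Hom.hom f)))
    (cechResolution_d x k)

theorem isZero_cechHomology_succ_iff (k : ℕ) :
    Limits.IsZero (cechHomology x X (k + 1)) ↔
      ∀ g ∈ famDeg R r ((Fin r → ℕ) → X) (k + 1), cechD x X g = 0 → ∃ w, cechD x X w = g := by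
  rw [← HomologicalComplex.exactAt_iff_isZero_homology,
    HomologicalComplex.exactAt_iff' _ (k + 2) (k + 1) k (by simp) (by simp),
    ShortComplex.moduleCat_exact_iff]
  have key : (∀ φ : (KoszulIndex r (k + 1) → InvPoly R r) →ₗ[R] X,
      φ ∘ₗ cechResolutionD x k = 0 → ∃ ψ : (KoszulIndex r (k + 2) → InvPoly R r) →ₗ[R] X,
        ψ ∘ₗ cechResolutionD x (k + 1) = φ) ↔
      ∀ g ∈ famDeg R r ((Fin r → ℕ) → X) (k + 1), cechD x X g = 0 →
        ∃ w, cechD x X w = g := by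
    constructor
    · intro h g hg hg0
      have h1 := toFam_ofFam (R := R) (k + 1) g
      rw [famTrunc_of_mem hg] at h1
      obtain ⟨ψ, hψ⟩ := h (ofFam R (k + 1) g) (toFam_injective k (by
        rw [toFam_comp, h1, hg0]
        funext S b
        simp [toFam]))
      exact ⟨toFam (k + 2) ψ, by rw [← toFam_comp, hψ, h1]⟩
    · intro h φ hφ
      obtain ⟨w, hw⟩ := h (toFam (k + 1) φ) (toFam_mem_famDeg φ) (by
        rw [← toFam_comp, hφ]
        funext S b
        simp [toFam])
      refine ⟨ofFam R (k + 2) w, toFam_injective (k + 1) ?_⟩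
      rw [toFam_comp, toFam_ofFam, kosD_famTrunc, hw, famTrunc_of_mem (toFam_mem_famDeg φ)]
  rw [← key]
  change (∀ φ : (KoszulIndex r (k + 1) → InvPoly R r) →ₗ[R] X,
    (cechHomComplex x X).d (k + 1) k φ = 0 →
      ∃ ψ : (KoszulIndex r (k + 2) → InvPoly R r) →ₗ[R] X,
        (cechHomComplex x X).d (k + 2) (k + 1) ψ = φ) ↔ _
  rw [cechHomComplex_d, cechHomComplex_d]
  rfl

theorem bijective_cechHomologyZeroToCompletion_iff :
    Function.Bijective (cechHomologyZeroToCompletion x X) ↔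
      Function.Surjective (cechEval x X) ∧
        ∀ φ, cechEval x X φ = 0 → ∃ ψ, ψ ∘ₗ cechResolutionD x 0 = φ := by
  have hcomp : ⇑(cechHomologyZeroToCompletion x X) =
      (ULift.moduleEquiv : ULift.{max u v} (Completion x X) ≃ₗ[R] Completion x X) ∘
        ((cechHomComplex x X).homologyι 0 ≫
          (cechHomComplex x X).descOpcycles (cechEvalHom x X) 1 (by simp)
            (d_comp_cechEvalHom x X)) := rfl
  rw [hcomp, Function.Bijective.of_comp_iff' (LinearEquiv.bijective _),
    bijective_homologyι_comp_descOpcycles_iff, cechHomComplex_d]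
  refine and_congr ⟨fun h y => ?_, fun h y => ?_⟩ (forall_congr' fun φ => ?_)
  · obtain ⟨φ, hφ⟩ := h (ULift.up y)
    exact ⟨φ, congrArg ULift.down hφ⟩
  · obtain ⟨φ, hφ⟩ := h y.down
    exact ⟨φ, ULift.ext _ _ hφ⟩
  · exact imp_congr ⟨fun h => congrArg ULift.down h, fun h => ULift.ext _ _ h⟩ Iff.rfl

theorem surjective_cechEval : Function.Surjective (cechEval x X) := by
  intro y
  obtain ⟨g, hg⟩ := exists_evalBox_eq x y
  refine ⟨ofFam R 0 fun _ => g, AdicCompletion.ext fun n => ?_⟩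
  rw [cechEval_val, toFam_ofFam, ← hg n]
  rfl

/-- This identifies the completion with the limit of the truncated homology in degree 0. -/
theorem cechEval_eq_zero_iff (φ : (KoszulIndex r 0 → InvPoly R r) →ₗ[R] X) :
    cechEval x X φ = 0 ↔ ∀ n, toFam 0 φ ∈ boxBoundaries x X n := by
  have h1 : cechEval x X φ = 0 ↔
      ∀ n, evalBox x X n (toFam 0 φ ∅) ∈ (seqIdeal x ^ n • ⊤ : Submodule R X) := by
    constructor
    · intro h n
      rw [← Submodule.Quotient.mk_eq_zero, ← Submodule.mkQ_apply, ← cechEval_val, h]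
      rfl
    · refine fun h => AdicCompletion.ext fun n => ?_
      rw [cechEval_val, Submodule.mkQ_apply, (Submodule.Quotient.mk_eq_zero _).2 (h n)]
      rfl
  rw [h1]
  exact ⟨mem_boxBoundaries_of_evalBox_mem (toFam_mem_famDeg φ),
    fun h n => evalBox_mem_of_mem_boxBoundaries (h n)⟩

/-- Surjectivity is automatic; what remains is the vanishing of the `lim¹` term in degree 0. -/
theorem bijective_cechHomologyZeroToCompletion_iff_forall :
    Function.Bijective (cechHomologyZeroToCompletion x X) ↔
      ∀ g ∈ famDeg R r ((Fin r → ℕ) → X) 0, (∀ n, g ∈ boxBoundaries x X n) →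
        ∃ w, cechD x X w = g := by
  rw [bijective_cechHomologyZeroToCompletion_iff]
  constructor
  · rintro ⟨-, h⟩ g hg hB
    have h1 := toFam_ofFam (R := R) 0 g
    rw [famTrunc_of_mem hg] at h1
    obtain ⟨ψ, hψ⟩ := h (ofFam R 0 g) ((cechEval_eq_zero_iff x X _).2 (by rwa [h1]))
    exact ⟨toFam 1 ψ, by rw [← toFam_comp, hψ, h1]⟩
  · refine fun h => ⟨surjective_cechEval x X, fun φ hφ => ?_⟩
    obtain ⟨w, hw⟩ := h _ (toFam_mem_famDeg φ) ((cechEval_eq_zero_iff x X φ).1 hφ)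
    refine ⟨ofFam R 1 w, toFam_injective 0 ?_⟩
    rw [toFam_comp, toFam_ofFam, kosD_famTrunc, hw, famTrunc_of_mem (toFam_mem_famDeg φ)]

theorem homologyMap_koszulTransition_eq_zero_iff {m n : ℕ} (h : n ≤ m) (k : ℕ) :
    HomologicalComplex.homologyMap (koszulTransition x X h) (k + 1) = 0 ↔
      ∀ f ∈ famDeg R r X (k + 1), powD x X m f = 0 → ∃ w, powD x X n w = famPow x m n f := by
  rw [homologyMap_eq_zero_iff, koszulComplex_d, koszulComplex_d]
  have key : (∀ a : KoszulIndex r (k + 1) → X, koszulD (fun i => x i ^ m) X k a = 0 →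
      ∃ b : KoszulIndex r (k + 2) → X,
        koszulD (fun i => x i ^ n) X (k + 1) b = koszulPowMap x X m n (k + 1) a) ↔
      ∀ f ∈ famDeg R r X (k + 1), powD x X m f = 0 →
        ∃ w, powD x X n w = famPow x m n f := by
    constructor
    · intro h f hf hf0
      have h1 := koszulExt_restrict (k + 1) f
      rw [famTrunc_of_mem hf] at h1
      obtain ⟨b, hb⟩ := h (fun S => f S.1) (koszulExt_injective k (by
        rw [← powD_koszulExt, h1, hf0, koszulExt_zero]))
      exact ⟨koszulExt (k + 2) b, by rw [powD_koszulExt, hb, ← famPow_koszulExt, h1]⟩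
    · intro h a ha
      obtain ⟨w, hw⟩ := h (koszulExt (k + 1) a) (koszulExt_mem_famDeg a) (by
        rw [powD_koszulExt, ha, koszulExt_zero])
      refine ⟨fun S => w S.1, koszulExt_injective (k + 1) ?_⟩
      rw [← powD_koszulExt, koszulExt_restrict, kosD_famTrunc, hw, famPow_koszulExt,
        famTrunc_of_mem (koszulExt_mem_famDeg (R := R) _)]
  exact key

variable {X} in
theorem famPow_famPow {l m n : ℕ} (hlm : l ≤ m) (hmn : m ≤ n) (f : Finset (Fin r) → X) :
    famPow x m l (famPow x n m f) = famPow x n l f := by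
  funext S
  simp only [famPow, smul_smul, ← Finset.prod_mul_distrib, ← pow_add]
  rw [show m - l + (n - m) = n - l by omega]

variable {X} in
theorem powD_famPow {m n : ℕ} (h : n ≤ m) (f : Finset (Fin r) → X) :
    powD x X n (famPow x m n f) = famPow x m n (powD x X m f) := by
  funext T
  rw [famPow, kosD_apply, kosD_apply, Finset.smul_sum]
  refine Finset.sum_congr rfl fun i _ => ?_
  by_cases hi : i ∈ T
  · rw [if_pos hi, if_pos hi, smul_zero]
  · rw [if_neg hi, if_neg hi, smul_comm (∏ i ∈ T, _) (koszulSign _ _), famPow,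
      Finset.prod_insert hi]
    simp only [LinearMap.smul_apply, LinearMap.id_apply, smul_smul]
    congr 2
    rw [← mul_assoc, ← pow_add, Nat.add_sub_cancel' h, mul_comm]

theorem isWeaklyProRegular_iff_isProZeroBox :
    IsWeaklyProRegular x X ↔ ∀ k, IsProZeroBox x X (k + 1) := by
  constructor
  · intro h k n
    obtain ⟨m, hm, hmap⟩ := h (k + 1) k.succ_pos (n + 1)
    refine ⟨m, (Nat.le_succ n).trans hm, ?_⟩
    exact (boxCycles_le_boxBoundaries x n.succ_pos hm
      ((homologyMap_koszulTransition_eq_zero_iff x X hm k).1 hmap)).trans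
        (boxBoundaries_antitone x (Nat.le_succ n))
  · intro h i hi n
    obtain ⟨k, rfl⟩ := Nat.exists_eq_succ_of_ne_zero hi.ne'
    -- The comparison needs a positive exponent; for `n = 0` the transition map factors through
    -- exponent 1.
    rcases Nat.eq_zero_or_pos n with rfl | hn
    · obtain ⟨m, hm, hle⟩ := h k 1
      refine ⟨m, m.zero_le, (homologyMap_koszulTransition_eq_zero_iff x X _ k).2
        fun f hf hf0 => ?_⟩
      obtain ⟨w, hw⟩ := exists_powD_eq_famPow x one_pos hm hle f hf hf0
      refine ⟨famPow x 1 0 w, ?_⟩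
      rw [powD_famPow x (Nat.zero_le 1), hw, famPow_famPow x (Nat.zero_le 1) hm]
    · obtain ⟨m, hm, hle⟩ := h k n
      exact ⟨m, hm, (homologyMap_koszulTransition_eq_zero_iff x X hm k).2
        (exists_powD_eq_famPow x hn hm hle)⟩

theorem cechHomologyIsCompletion_iff :
    CechHomologyIsCompletion x X ↔
      (∀ k, ∀ g ∈ famDeg R r ((Fin r → ℕ) → X) (k + 1), cechD x X g = 0 →
        ∃ w, cechD x X w = g) ∧
      ∀ g ∈ famDeg R r ((Fin r → ℕ) → X) 0, (∀ n, g ∈ boxBoundaries x X n) →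
        ∃ w, cechD x X w = g := by
  unfold CechHomologyIsCompletion
  rw [bijective_cechHomologyZeroToCompletion_iff_forall]
  refine and_congr_left fun _ => ⟨fun h k => ?_, fun h i hi => ?_⟩
  · exact (isZero_cechHomology_succ_iff x X k).1 (h _ k.succ_pos)
  · obtain ⟨k, rfl⟩ := Nat.exists_eq_succ_of_ne_zero hi.ne'
    exact (isZero_cechHomology_succ_iff x X k).2 (h k)

variable {X}

/-- In positive degree, pro-vanishing in that degree makes a cycle a boundary modulo every box, and
pro-vanishing one degree higher makes it a boundary. In degree 0 only the second half is needed. -/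
theorem IsWeaklyProRegular.cechHomologyIsCompletion (h : IsWeaklyProRegular x X) :
    CechHomologyIsCompletion x X := by
  rw [isWeaklyProRegular_iff_isProZeroBox] at h
  refine (cechHomologyIsCompletion_iff x X).2 ⟨fun k g hg hg0 => ?_, fun g hg hB =>
    mem_range_of_forall_mem_boxBoundaries (h 0) hg hB⟩
  refine mem_range_of_forall_mem_boxBoundaries (h (k + 1)) hg fun n => ?_
  obtain ⟨m, -, hm⟩ := h k n
  exact hm ⟨hg, by
    change cechD x X g ∈ famFil R r X m
    rw [hg0]
    exact Submodule.zero_mem _⟩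

/-- The index `m` found for `M` serves all coordinates at once, and on a box a family has only
finitely many nonzero coordinates, so finitely many primitives are added. -/
theorem IsWeaklyProRegular.of_linearEquiv_finsupp {M : Type w} [AddCommGroup M] [Module R M]
    {S : Type*} (e : X ≃ₗ[R] (S →₀ M)) (h : IsWeaklyProRegular x M) :
    IsWeaklyProRegular x X := by
  classical
  rw [isWeaklyProRegular_iff_isProZeroBox] at h ⊢
  intro k n
  obtain ⟨m, hm, hle⟩ := h k n
  refine ⟨m, hm, fun g hg => ?_⟩
  let emb : S → M →ₗ[R] X := fun s => e.symm.toLinearMap ∘ₗ Finsupp.lsingle s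
  let coef : S → X →ₗ[R] M := fun s => Finsupp.lapply s ∘ₗ e.toLinearMap
  have hcoef : ∀ s t (w : PowFam r M), famMap (coef s) (famMap (emb t) w) =
      if t = s then w else 0 := by
    intro s t w
    funext T b
    rw [famMap_apply, famMap_apply]
    simp only [coef, emb, LinearMap.comp_apply, LinearEquiv.coe_coe, LinearEquiv.apply_symm_apply,
      Finsupp.lsingle_apply, Finsupp.lapply_apply, Finsupp.single_apply]
    split_ifs <;> rfl
  choose w hw using fun s => mem_boxBoundaries.1 (hle (famMap_mem_boxCycles (coef s) hg))
  let A : Finset S :=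
    Finset.univ.biUnion fun T => (expBox r n).biUnion fun b => (e (g T b)).support
  rw [mem_boxBoundaries]
  refine ⟨∑ t ∈ A, famMap (emb t) (w t), fun T b hb => ?_⟩
  refine e.injective (Finsupp.ext fun s => ?_)
  rw [map_zero, Finsupp.zero_apply]
  change famMap (coef s) (g - cechD x X (∑ t ∈ A, famMap (emb t) (w t))) T b = 0
  rw [map_sub, ← cechD_famMap, map_sum]
  simp only [hcoef]
  rw [Finset.sum_ite_eq']
  split_ifs with hs
  · exact hw s T b hb
  · rw [map_zero, sub_zero]
    by_contra hne
    exact hs (Finset.mem_biUnion.2 ⟨T, Finset.mem_univ _, Finset.mem_biUnion.2 ⟨b, hb,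
      Finsupp.mem_support_iff.2 hne⟩⟩)

theorem isWeaklyProRegular_of_cechHomologyIsCompletion {M : Type w} [AddCommGroup M]
    [Module R M] (e : X ≃ₗ[R] (ℕ →₀ M)) (h : CechHomologyIsCompletion x X) :
    IsWeaklyProRegular x M := by
  rw [cechHomologyIsCompletion_iff] at h
  refine (isWeaklyProRegular_iff_isProZeroBox x M).2 fun k =>
    isProZeroBox_of_exact e (fun g hg hg0 hB => ?_) (h.1 k)
  -- For `k = 0` this is injectivity into the completion; for larger `k` it follows from exactness.
  cases k with
  | zero => exact h.2 g hg hB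
  | succ k => exact h.1 k g hg hg0

end Homology

/-! ### The equivalence -/

theorem theorem3p4 {R : Type u} [CommRing R] {r : ℕ} (x : Fin r → R)
    (M : Type v) [AddCommGroup M] [Module R M] :
    List.TFAE [
      IsWeaklyProRegular x M,
      ∀ S : Type w, CechHomologyIsCompletion x (S →₀ M),
      CechHomologyIsCompletion x (PolynomialModule R M) ∧ CechHomologyIsCompletion x M,
      CechHomologyIsCompletion x (PolynomialModule R M)] := by
  tfae_have 1 → 2 := fun h S =>
    (h.of_linearEquiv_finsupp x (LinearEquiv.refl R (S →₀ M))).cechHomologyIsCompletion x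
  tfae_have 1 → 3 := fun h =>
    ⟨(h.of_linearEquiv_finsupp x (PolynomialModule.coeffLinearEquiv R R)).cechHomologyIsCompletion x,
      h.cechHomologyIsCompletion x⟩
  tfae_have 3 → 4 := And.left
  tfae_have 4 → 1 := isWeaklyProRegular_of_cechHomologyIsCompletion x
    (PolynomialModule.coeffLinearEquiv R R)
  tfae_have 2 → 1 := fun h => isWeaklyProRegular_of_cechHomologyIsCompletion x
    -- A countable index set suffices, lifted to the universe over which `S` ranges.
    (Finsupp.domLCongr Equiv.ulift) (h (ULift ℕ))
  tfae_finish
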